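/- **Parameters.** Let $\varepsilon_1,\dots,\varepsilon_4\in\mathbb C$ with $\sum_a\varepsilon_a=0$ and put $q_a=e^{\varepsilon_a}$, so that $q_1q_2q_3q_4=1$. Assume the $q_a$ are otherwise independent: $\prod_a q_a^{m_a}=1$ with $m\in\mathbb Z^4$ only if $m_1=m_2=m_3=m_4$. For $S\subseteq\{1,2,3,4\}$ put $P_S^{[n]}=\prod_{a\in S}(1-q_a^n)$ and $P_S^\vee=\prod_{a\in S}(1-q_a^{-1})$, and let $\bar a=\{1,2,3,4\}\setminus\{a\}$. For a virtual character with equal weights collected, $\mathbb I[\sum_i n_iw_i]=\prod_i(1-w_i^{-1})^{n_i}$; $X^\vee$ denotes $X$ with all weights inverted. A plane partition $\pi$ is a finite lower set of boxes $(i,j,k)\in\mathbb Z_{\ge1}^3$, and $|\pi|$ is its number of boxes. For $\bar a=\{b<c<d\}$ and a box $s=(i,j,k)$ put $\chi_{\bar a,x}(s)=x\,q_b^{i-1}q_c^{j-1}q_d^{k-1}$. **BPS side.** The $U(1)$ partition function of the 7d theory on $\mathbb C^3_{\bar a}\times S^1$ is $$\widetilde{\mathcal Z}_{\bar a}[\pi]=\mathbb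 I\bigl[-P_a^\vee N^\vee K+P_{\bar a}^\vee K^\vee K\bigr],\qquad N=v,\quad K=\sum_{s\in\pi}\chi_{\bar a,v}(s),$$ which does not depend on $v$. With $\mathscr V_a(x)=\frac{1-q_ax}{1-x}$ and $\mathcal A(x)=\frac{\prod_{i}(1-q_ix)(1-q_i^{-1}x)}{(1-x)^2\prod_{i<j}(1-q_iq_jx)}$ put $$\mathcal Z_{\bar a|\bar b}(x_1,\pi_1\,|\,x_2,\pi_2)=\prod_{s\in\pi_1}q_b\frac{1-q_b^{-1}\chi_{\bar a,x_1}(s)/x_2}{1-\chi_{\bar a,x_1}(s)/x_2}\prod_{s'\in\pi_2}\mathscr V_a\!\left(\frac{x_1}{\chi_{\bar b,x_2}(s')}\right)\prod_{s\in\pi_1,\,s'\in\pi_2}\mathcal A\!\left(\frac{\chi_{\bar a,x_1}(s)}{\chi_{\bar b,x_2}(s')}\right)^{-1},$$ $$\mathcal Z_{\text{1-loop}}(x_1,\bar a\,|\,x_2,\bar b)=\exp\Bigl(-\sum_{n>0}\frac1n\frac{P_a^{[n]}P_b^{[-n]}}{P_{1234}^{[n]}}\Bigl(\frac{x_1}{x_2}\Bigr)^n\Bigr).$$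 Let $n_{\bar a}\ge0$ ($a=1,\dots,4$), let $v_{\bar a,\alpha}$ ($1\le\alpha\le n_{\bar a}$) be formal variables, and order the pairs $(a,\alpha)$ lexicographically. For a tuple $\underline{\vec\pi}=(\pi_{\bar a}^{(\alpha)})$ of plane partitions of total size $|\underline{\vec\pi}|$ put $$\mathcal Z_{\text{tet.inst.}}[\underline{\vec v},\underline{\vec\pi}]=\prod_{a,\alpha}\widetilde{\mathcal Z}_{\bar a}[\pi_{\bar a}^{(\alpha)}]\prod_{a}\prod_{\alpha<\beta}\mathcal Z_{\bar a|\bar a}(v_{\bar a,\alpha},\pi_{\bar a}^{(\alpha)}|v_{\bar a,\beta},\pi_{\bar a}^{(\beta)})\prod_{a<b}\prod_{\alpha,\beta}\mathcal Z_{\bar a|\bar b}(v_{\bar a,\alpha},\pi_{\bar a}^{(\alpha)}|v_{\bar b,\beta},\pi_{\bar b}^{(\beta)}),$$ $$\mathcal Z_{\text{inst.}}=\sum_{\underline{\vec\pi}}\mathfrak q^{|\underline{\vec\pi}|}\mathcal Z_{\text{tet.inst.}}[\underline{\vec v},\underline{\vec\pi}],\qquad \mathcal Z_{\text{1-loop}}=\prod_{(a,\alpha)<(b,\beta)}\mathcal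 Z_{\text{1-loop}}(v_{\bar a,\alpha},\bar a\,|\,v_{\bar b,\beta},\bar b).$$ **CFT side.** Let $\mathsf a_n$ ($n\in\mathbb Z\setminus\{0\}$) satisfy $[\mathsf a_n,\mathsf a_m]=-\frac1nP_{1234}^{[n]}\delta_{n+m,0}$, and let $t_0,\tilde t_0,\partial_t$ be zero modes which commute with the $\mathsf a_n$ and satisfy $[\partial_t,t_0]=1$, $[\partial_t,\tilde t_0]=[t_0,\tilde t_0]=0$. The vacua satisfy $\mathsf a_n|0\rangle=\partial_t|0\rangle=0$ and $\langle0|\mathsf a_{-n}=\langle0|t_0=\langle0|\tilde t_0=0$ for $n>0$, and $\langle0|0\rangle=1$. Normal ordering $:\ :$ puts $\mathsf a_{-n}$ ($n>0$), $t_0$, $\tilde t_0$ to the left. With $\log q_a:=\varepsilon_a$ put $$\mathsf A(x)=e^{t_0}:\exp\Bigl(\sum_{n\ne0}\mathsf a_nx^{-n}\Bigr):,\qquad \mathsf W_{\bar a}(x)=e^{-\varepsilon_a(\log x+\log(-q_a))\tilde t_0}\,e^{-\varepsilon_a\partial_t}:\exp\Bigl(\sum_{n\neq0}\frac{\mathsf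 a_n}{P_{\bar a}^{[-n]}}x^{-n}\Bigr):,$$ $$\Lambda_{\bar a,\pi}(x)=\;:\mathsf W_{\bar a}(x)\prod_{s\in\pi}\mathsf A(\chi_{\bar a,x}(s))^{-1}:,\qquad \mathsf T_{\bar a}(x)=\sum_{\pi}\mathfrak q^{|\pi|}\,\widetilde{\mathcal Z}_{\bar a}[\pi]\,\Lambda_{\bar a,\pi}(x).$$ Thus the coefficients of the D6 $qq$-character $\mathsf T_{\bar a}$ are the 7d $U(1)$ partition functions. The $\log x$ in the zero modes may be given any complex value, separately for each spectral parameter. **Theorem.** With the operators with larger $(a,\alpha)$ standing to the left, $$\mathcal Z_{\text{1-loop}}\mathcal Z_{\text{inst.}}=\sum_{\underline{\vec\pi}}\mathfrak q^{|\underline{\vec\pi}|}\mathcal Z_{\text{1-loop}}\mathcal Z_{\text{tet.inst.}}[\underline{\vec v},\underline{\vec\pi}]=\langle0|\prod_{a=1}^4\prod_{\alpha=1}^{n_{\bar a}}\mathsf T_{\bar a}(v_{\bar a,\alpha})|0\rangle .$$ This is an identity of formal power series in $\mathfrak q$ whose coefficients are formal series in the $v_{\bar a,\alpha}$; on the left,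 rational functions are expanded in the region $|v_{\bar a,\alpha}|\ll|v_{\bar b,\beta}|$ for $(a,\alpha)<(b,\beta)$. In the same sense: 1. $\langle0|\mathsf T_{\bar a}(v)|0\rangle=\sum_\pi\mathfrak q^{|\pi|}\widetilde{\mathcal Z}_{\bar a}[\pi]$ (7d $U(1)$ theory on $\mathbb C^3_{\bar a}\times S^1$). 2. For every $N\ge 0$ (7d $U(N)$ theory on $\mathbb C^3_{\bar a}\times S^1$), $$\langle0|\mathsf T_{\bar a}(v_N)\cdots\mathsf T_{\bar a}(v_1)|0\rangle=\prod_{\alpha<\beta}\mathcal Z_{\text{1-loop}}(v_\alpha,\bar a|v_\beta,\bar a)\sum_{\pi_1,\dots,\pi_N}\mathfrak q^{\sum_\alpha|\pi_\alpha|}\prod_\alpha\widetilde{\mathcal Z}_{\bar a}[\pi_\alpha]\prod_{\alpha<\beta}\mathcal Z_{\bar a|\bar a}(v_\alpha,\pi_\alpha|v_\beta,\pi_\beta).$$ 3. For $123=\bar4$ and $234=\bar1$ (generalized folded instantons D6$_{123}$-D6$_{234}$-D0), $$\langle0|\mathsf T_{123}(v)\mathsf T_{234}(v')|0\rangle=\mathcal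 Z_{\text{1-loop}}(v',\bar1|v,\bar4)\sum_{\pi',\pi}\mathfrak q^{|\pi'|+|\pi|}\,\widetilde{\mathcal Z}_{\bar1}[\pi']\,\widetilde{\mathcal Z}_{\bar4}[\pi]\,\mathcal Z_{\bar1|\bar4}(v',\pi'|v,\pi).$$ -/

import Mathlib

open scoped TensorProduct

noncomputable section

namespace GaugeOrigami

/-! ### Plane partitions -/

/-- A plane partition, as a finite stack of cubes: a finite lower set of `ℕ³`
(cubes are indexed from `0`, so the cube `(i, j, k)` here is `(i+1, j+1, k+1)` in the
one-based convention). -/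
@[ext]
structure PlanePartition where
  cells : Finset (Fin 3 → ℕ)
  isLowerSet : IsLowerSet (cells : Set (Fin 3 → ℕ))

/-- The number `|π|` of cubes. -/
def PlanePartition.size (π : PlanePartition) : ℕ := π.cells.card

theorem PlanePartition.lt_size (π : PlanePartition) {c : Fin 3 → ℕ} (hc : c ∈ π.cells)
    (i : Fin 3) : c i < π.size := by
  have hsub : (Finset.range (c i + 1)).image (fun j => Function.update c i j) ⊆ π.cells := by
    intro x hx
    obtain ⟨j, hj, rfl⟩ := Finset.mem_image.1 hx
    have hle : Function.update c i j ≤ c :=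
      update_le_iff.2 ⟨Nat.lt_succ_iff.1 (Finset.mem_range.1 hj), fun _ _ => le_rfl⟩
    exact π.isLowerSet hle hc
  have hcard := Finset.card_le_card hsub
  rw [Finset.card_image_of_injective _ (Function.update_injective c i),
    Finset.card_range] at hcard
  exact hcard

theorem PlanePartition.finite_size_le (k : ℕ) : Finite {π : PlanePartition // π.size ≤ k} := by
  refine Finite.of_injective
    (β := {s // s ∈ (Fintype.piFinset fun _ : Fin 3 => Finset.range k).powerset})
    (fun π => ⟨π.1.cells, Finset.mem_powerset.2 fun c hc => Fintype.mem_piFinset.2 fun i =>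
      Finset.mem_range.2 ((π.1.lt_size hc i).trans_le π.2)⟩) ?_
  intro π π' h
  exact Subtype.ext (PlanePartition.ext (Subtype.ext_iff.1 h))

/-- There are finitely many tuples of plane partitions of given total size. -/
instance {ι : Type*} [Fintype ι] (k : ℕ) :
    Fintype {π : ι → PlanePartition // ∑ i, (π i).size = k} := by
  haveI := PlanePartition.finite_size_le k
  haveI : Finite {π : ι → PlanePartition // ∑ i, (π i).size = k} := by
    refine Finite.of_injective (β := ι → {π : PlanePartition // π.size ≤ k})
      (fun π i => ⟨π.1 i, (Finset.single_le_sum (f := fun i => (π.1 i).size)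
        (fun _ _ => Nat.zero_le _) (Finset.mem_univ i)).trans π.2.le⟩) ?_
    intro π π' h
    exact Subtype.ext (funext fun i => Subtype.ext_iff.1 (congrFun h i))
  exact Fintype.ofFinite _

instance (k : ℕ) : Fintype {π : PlanePartition // π.size = k} := by
  haveI := PlanePartition.finite_size_le k
  haveI : Finite {π : PlanePartition // π.size = k} :=
    Finite.of_injective (β := {π : PlanePartition // π.size ≤ k}) (fun π => ⟨π.1, π.2.le⟩)
      fun π π' h => Subtype.ext (congrArg (fun x => x.1) h)
  exact Fintype.ofFinite _

/-! ### Parameters, characters and the index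

The set `{1, 2, 3, 4}` is `Fin 4`.  The face `ā = {1, 2, 3, 4} ∖ {a}` is labelled by `a`, and its
three elements are `a.succAbove 0 < a.succAbove 1 < a.succAbove 2`. -/

/-- The parameter `q_a = e^{ε_a}`. -/
def q (ε : Fin 4 → ℂ) (a : Fin 4) : ℂˣ := Units.mk0 (Complex.exp (ε a)) (Complex.exp_ne_zero _)

/-- `P_S^{[n]} = ∏_{a ∈ S} (1 - q_a^n)`. -/
def P (ε : Fin 4 → ℂ) (S : Finset (Fin 4)) (n : ℤ) : ℂ :=
  ∏ a ∈ S, (1 - ((q ε a ^ n : ℂˣ) : ℂ))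

/-- The ratio `χ_{ā,v}(c) / v = ∏_{i ∈ ā} q_i^{c_i}` for a cube `c`. -/
def boxWeight (ε : Fin 4 → ℂ) (a : Fin 4) (c : Fin 3 → ℕ) : ℂˣ :=
  ∏ i : Fin 3, q ε (a.succAbove i) ^ c i

/-- Virtual characters `∑ n_i w_i` (`n_i ∈ ℤ`) with weights `w_i ∈ ℂˣ`; equal weights are
collected. -/
abbrev Character := MonoidAlgebra ℤ ℂˣ

/-- The character with the single weight `w`. -/
def Character.weight (w : ℂˣ) : Character := MonoidAlgebra.single w 1

/-- The index `𝕀[∑ n_i w_i] = ∏ (1 - w_i⁻¹)^{n_i}`. -/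
def index (X : Character) : ℂ :=
  ∏ w ∈ X.coeff.support, (1 - ((w⁻¹ : ℂˣ) : ℂ)) ^ (X.coeff w)

/-- The dual character `P_S^∨ = ∏_{a ∈ S} (1 - q_a⁻¹)`. -/
def dualP (ε : Fin 4 → ℂ) (S : Finset (Fin 4)) : Character :=
  ∏ a ∈ S, (1 - Character.weight (q ε a)⁻¹)

/-- The `U(1)` partition function `Z̃_ā[π]` of the 7d theory on `ℂ³_ā × S¹`: the index of
`- P_a^∨ N^∨ K + P_ā^∨ K^∨ K` with `N = v` and `K = ∑_{c ∈ π} χ_{ā,v}(c)`. It does not depend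
on `v`, which is set to `1`. -/
def Z7 (ε : Fin 4 → ℂ) (a : Fin 4) (π : PlanePartition) : ℂ :=
  index (-(dualP ε {a} * ∑ c ∈ π.cells, Character.weight (boxWeight ε a c)) +
    dualP ε {a}ᶜ * (∑ c ∈ π.cells, Character.weight (boxWeight ε a c)⁻¹) *
      ∑ c ∈ π.cells, Character.weight (boxWeight ε a c))

/-! ### The D6-D6 factors -/

section Factors

variable {K : Type*} [Field K]

/-- `𝒱_a(x) = (1 - q_a x) / (1 - x)`. -/
def structV (p : Fin 4 → K) (a : Fin 4) (x : K) : K := (1 - p a * x) / (1 - x)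

/-- `𝒜_{ℂ⁴}(x) = 𝕀[-P_{1234}^∨ x^∨]
  = ∏_i (1 - q_i x) ∏_i (1 - q_i⁻¹ x) / ((1 - x)² ∏_{i<j} (1 - q_i q_j x))`. -/
def structA (p : Fin 4 → K) (x : K) : K :=
  ((∏ i, (1 - p i * x)) * ∏ i, (1 - (p i)⁻¹ * x)) /
    ((1 - x) ^ 2 * ∏ ij : Fin 4 × Fin 4 with ij.1 < ij.2, (1 - p ij.1 * p ij.2 * x))

/-- `χ_{ā,x}(c) = x ∏_{i ∈ ā} q_i^{c_i}`. -/
def boxContent (p : Fin 4 → K) (a : Fin 4) (x : K) (c : Fin 3 → ℕ) : K :=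
  x * ∏ i : Fin 3, p (a.succAbove i) ^ c i

/-- The factor `Z_{ā|b̄}(x₁, π₁ | x₂, π₂)`. -/
def pairZ (p : Fin 4 → K) (a b : Fin 4) (x₁ : K) (π₁ : PlanePartition)
    (x₂ : K) (π₂ : PlanePartition) : K :=
  (∏ c ∈ π₁.cells, p b * ((1 - (p b)⁻¹ * boxContent p a x₁ c / x₂) /
      (1 - boxContent p a x₁ c / x₂))) *
    (∏ c' ∈ π₂.cells, structV p a (x₁ / boxContent p b x₂ c')) *
    ∏ c ∈ π₁.cells, ∏ c' ∈ π₂.cells,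
      (structA p (boxContent p a x₁ c / boxContent p b x₂ c'))⁻¹

end Factors

/-! ### Formal spectral parameters

For a finite linearly ordered set `ι` of branes, rational functions of the spectral parameters
`v_i` are expanded in the region `|v_i| ≪ |v_j|` for `i < j`: this is the field of Hahn series
whose exponents `ℤ^ι` are ordered lexicographically, the smallest index first. -/

/-- The field of iterated formal Laurent series in the ratios `v_i / v_j`, `i < j`. -/
abbrev SpectralField (ι : Type) [LinearOrder ι] [Fintype ι] : Type :=
  HahnSeries (Lex (ι → ℤ)) ℂ

section Spectral

variable {ι : Type} [LinearOrder ι] [Fintype ι]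

/-- The formal variable `v_i`. -/
def specVar (i : ι) : SpectralField ι := HahnSeries.single (toLex (Pi.single i (1 : ℤ))) 1

/-- A complex number as a constant. -/
def const (z : ℂ) : SpectralField ι := HahnSeries.C z

/-- The parameters `q_a` as constants. -/
def qConst (ε : Fin 4 → ℂ) (a : Fin 4) : SpectralField ι := const (q ε a : ℂ)

end Spectral

/-- `exp f = ∑_k f^k / k!` for a formal power series `f` without constant term over a possibly
noncommutative `ℂ`-algebra (then only `k ≤ n` contributes to the coefficient of degree `n`). -/
def formalExp {R : Type*} [Ring R] [Algebra ℂ R] (f : PowerSeries R) : PowerSeries R :=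
  PowerSeries.mk fun n =>
    ∑ k ∈ Finset.range (n + 1), ((k.factorial : ℂ)⁻¹) • PowerSeries.coeff n (f ^ k)

/-- `exp (- ∑_{n>0} (1/n) (P_a^{[n]} P_b^{[-n]} / P_{1234}^{[n]}) zⁿ)`. -/
def oneLoopSeries (ε : Fin 4 → ℂ) (a b : Fin 4) : PowerSeries ℂ :=
  formalExp (PowerSeries.mk fun n : ℕ =>
    -(1 / (n : ℂ)) * (P ε {a} n * P ε {b} (-n) / P ε Finset.univ n))

section Partition

variable {ι : Type} [LinearOrder ι] [Fintype ι]

/-- `Z_{1-loop}(x₁, ā | x₂, b̄)`, the series above at `z = x₁ / x₂` (which has positive order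
when `x₁ = v_i`, `x₂ = v_j`, `i < j`). -/
def pairOneLoop (ε : Fin 4 → ℂ) (a b : Fin 4) (x₁ x₂ : SpectralField ι) : SpectralField ι :=
  PowerSeries.heval (x₁ / x₂) (oneLoopSeries ε a b)

/-- The one-loop factor `∏_{i < j} Z_{1-loop}(v_i, ā_i | v_j, ā_j)`, where the brane `i` wraps the
face `ā_i = face i`. -/
def oneLoop (ε : Fin 4 → ℂ) (face : ι → Fin 4) : SpectralField ι :=
  ∏ ij : ι × ι with ij.1 < ij.2,
    pairOneLoop ε (face ij.1) (face ij.2) (specVar ij.1) (specVar ij.2)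

end Partition

/-- The set of pairs `(a, α)`, `a ∈ {1,2,3,4}`, `1 ≤ α ≤ n_ā`, in lexicographic order. -/
abbrev Branes (n : Fin 4 → ℕ) : Type := Σₗ a : Fin 4, Fin (n a)

/-- The face wrapped by the brane `(a, α)`. -/
def Branes.face {n : Fin 4 → ℕ} (i : Branes n) : Fin 4 := (ofLex i).1

/-- The brane `(a, α)`. -/
def brane {n : Fin 4 → ℕ} (a : Fin 4) (α : Fin (n a)) : Branes n := toLex ⟨a, α⟩

/-- The contribution `Z_{tet.inst.}[v, π]` of a tuple `π` of plane partitions. -/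
def Ztet (ε : Fin 4 → ℂ) (n : Fin 4 → ℕ) (π : Branes n → PlanePartition) :
    SpectralField (Branes n) :=
  (∏ a : Fin 4, ∏ α : Fin (n a), const (Z7 ε a (π (brane a α)))) *
    (∏ a : Fin 4, ∏ αβ : Fin (n a) × Fin (n a) with αβ.1 < αβ.2,
      pairZ (qConst ε) a a (specVar (brane a αβ.1)) (π (brane a αβ.1))
        (specVar (brane a αβ.2)) (π (brane a αβ.2))) *
    ∏ ab : Fin 4 × Fin 4 with ab.1 < ab.2, ∏ α : Fin (n ab.1), ∏ β : Fin (n ab.2),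
      pairZ (qConst ε) ab.1 ab.2 (specVar (brane ab.1 α)) (π (brane ab.1 α))
        (specVar (brane ab.2 β)) (π (brane ab.2 β))

/-- The tetrahedron instanton partition function `∑_π 𝔮^{|π|} Z_{tet.inst.}[v, π]`, a formal power
series in `𝔮`. -/
def Zinst (ε : Fin 4 → ℂ) (n : Fin 4 → ℕ) : PowerSeries (SpectralField (Branes n)) :=
  PowerSeries.mk fun k =>
    ∑ π : {π : Branes n → PlanePartition // ∑ i, (π i).size = k}, Ztet ε n π.1

/-! ### The Heisenberg algebra and its Fock space -/

/-- The Fock space of the oscillators: polynomials in the creation operators `a_{-m}`, `m ≥ 1`,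
applied to the vacuum `1`. -/
abbrev Fock : Type := MvPolynomial ℕ+ ℂ

/-- The oscillators, `[a_n, a_m] = -(1/n) P_{1234}^{[n]} δ_{n+m,0}`: for `n > 0`, `a_{-n}` is the
multiplication by the variable `X_n` and `a_n = -(1/n) P_{1234}^{[n]} ∂/∂X_n`. There is no
oscillator `a_0`. -/
def heis (ε : Fin 4 → ℂ) : ℤ → Module.End ℂ Fock
  | .ofNat 0 => 0
  | .ofNat (m + 1) =>
      (-(1 / ((m : ℂ) + 1)) * P ε Finset.univ (m + 1)) •
        (MvPolynomial.pderiv (R := ℂ) m.succPNat).toLinearMap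
  | .negSucc m => LinearMap.mulLeft ℂ (MvPolynomial.X m.succPNat)

/-- The modes that occur in the exponents: the oscillators `a_n` (`n ≠ 0`; `a 0` is a dummy), and
the zero modes `t₀`, `t̃₀` and `∂_t` with `[∂_t, t₀] = 1`, `[∂_t, t̃₀] = [t₀, t̃₀] = 0`. -/
inductive Mode where
  | a (n : ℤ)
  | t
  | tTilde
  | dt

/-- A linear combination of modes, given by its coefficients. -/
abbrev Exponent : Type := Mode → ℂ

/-- `∑_{n>0} E_{-n} a_{-n} zⁿ`. -/
def creationSeries (ε : Fin 4 → ℂ) (E : Exponent) : PowerSeries (Module.End ℂ Fock) :=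
  PowerSeries.mk fun n : ℕ => E (.a (-(n : ℤ))) • heis ε (-(n : ℤ))

/-- `∑_{n>0} E_n a_n zⁿ`. -/
def annihilationSeries (ε : Fin 4 → ℂ) (E : Exponent) : PowerSeries (Module.End ℂ Fock) :=
  PowerSeries.mk fun n : ℕ => E (.a (n : ℤ)) • heis ε (n : ℤ)

/-- States all of whose monomials have degree at most `w`, where `a_{-m}` has degree `m`. -/
def degreeLE (w : ℕ) : Submodule ℂ Fock where
  carrier := {f | ∀ s ∈ f.support, Finsupp.weight (fun m : ℕ+ => (m : ℕ)) s ≤ w}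
  zero_mem' := by simp
  add_mem' := by
    intro f g hf hg s hs
    rcases Finset.mem_union.1 (MvPolynomial.support_add hs) with h | h
    · exact hf s h
    · exact hg s h
  smul_mem' := by
    intro c f hf s hs
    exact hf s (MvPolynomial.support_smul hs)

theorem exists_mem_degreeLE (f : Fock) : ∃ w, f ∈ degreeLE w :=
  ⟨f.support.sup (Finsupp.weight (fun m : ℕ+ => (m : ℕ))),
    fun _ hs => Finset.le_sup (f := Finsupp.weight (fun m : ℕ+ => (m : ℕ))) hs⟩

/-- `a_n`, `n ≥ 0`, lowers the degree by `n`. -/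
theorem heis_lowers (ε : Fin 4 → ℂ) (n w : ℕ) {f : Fock} (hf : f ∈ degreeLE w) :
    heis ε (n : ℤ) f ∈ degreeLE (w - n) ∧ (w < n → heis ε (n : ℤ) f = 0) := by
  cases n with
  | zero => exact ⟨(degreeLE _).zero_mem, fun h => absurd h (Nat.not_lt_zero _)⟩
  | succ n =>
    have key : ∀ s ∈ (MvPolynomial.pderiv (R := ℂ) n.succPNat f).support,
        Finsupp.weight (fun m : ℕ+ => (m : ℕ)) s + (n + 1) ≤ w := by
      intro s hs
      have h1 : s + Finsupp.single n.succPNat 1 ∈ f.support := by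
        rw [MvPolynomial.mem_support_iff] at hs ⊢
        intro h0
        exact hs (by rw [MvPolynomial.coeff_pderiv, h0, zero_mul])
      have h2 := hf _ h1
      rw [map_add, Finsupp.weight_single] at h2
      simpa using h2
    change (-(1 / ((n : ℂ) + 1)) * P ε Finset.univ (n + 1)) •
        MvPolynomial.pderiv (R := ℂ) n.succPNat f ∈ degreeLE (w - (n + 1)) ∧
      (w < n + 1 → (-(1 / ((n : ℂ) + 1)) * P ε Finset.univ (n + 1)) •
        MvPolynomial.pderiv (R := ℂ) n.succPNat f = 0)
    refine ⟨(degreeLE _).smul_mem _ fun s hs => Nat.le_sub_of_add_le (key s hs), fun h => ?_⟩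
    have h0 : MvPolynomial.pderiv (R := ℂ) n.succPNat f = 0 := by
      rw [← MvPolynomial.support_eq_empty, Finset.eq_empty_iff_forall_notMem]
      intro s hs
      have := key s hs
      omega
    rw [h0, smul_zero]

theorem annihilation_pow_lowers (ε : Fin 4 → ℂ) (E : Exponent) (k n w : ℕ) {f : Fock}
    (hf : f ∈ degreeLE w) :
    PowerSeries.coeff n (annihilationSeries ε E ^ k) f ∈ degreeLE (w - n) ∧
      (w < n → PowerSeries.coeff n (annihilationSeries ε E ^ k) f = 0) := by
  induction k generalizing n with
  | zero =>
    rw [pow_zero, PowerSeries.coeff_one]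
    split_ifs with h
    · subst h
      exact ⟨hf, fun h => absurd h (Nat.not_lt_zero _)⟩
    · exact ⟨(degreeLE _).zero_mem, fun _ => rfl⟩
  | succ k ih =>
    rw [pow_succ', PowerSeries.coeff_mul, LinearMap.sum_apply]
    have step : ∀ p ∈ Finset.HasAntidiagonal.antidiagonal n,
        (PowerSeries.coeff p.1 (annihilationSeries ε E) *
          PowerSeries.coeff p.2 (annihilationSeries ε E ^ k)) f ∈ degreeLE (w - n) ∧
        (w < n → (PowerSeries.coeff p.1 (annihilationSeries ε E) *
          PowerSeries.coeff p.2 (annihilationSeries ε E ^ k)) f = 0) := by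
      intro p hp
      have hp' := Finset.HasAntidiagonal.mem_antidiagonal.1 hp
      obtain ⟨h1, h2⟩ := ih p.2
      obtain ⟨h3, h4⟩ := heis_lowers ε p.1 (w - p.2) h1
      simp only [annihilationSeries, PowerSeries.coeff_mk, Module.End.mul_apply,
        LinearMap.smul_apply] at *
      refine ⟨?_, fun hw => ?_⟩
      · have e : w - p.2 - p.1 = w - n := by omega
        rw [e] at h3
        exact (degreeLE _).smul_mem _ h3
      · by_cases h5 : w < p.2
        · rw [h2 h5, map_zero, smul_zero]
        · rw [h4 (by omega), smul_zero]
    exact ⟨(degreeLE _).sum_mem fun p hp => (step p hp).1,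
      fun hw => Finset.sum_eq_zero fun p hp => (step p hp).2 hw⟩

theorem annihilation_finite (ε : Fin 4 → ℂ) (E : Exponent) (f : Fock) :
    ∃ w, ∀ l, w < l → PowerSeries.coeff l (formalExp (annihilationSeries ε E)) f = 0 := by
  obtain ⟨w, hw⟩ := exists_mem_degreeLE f
  refine ⟨w, fun l hl => ?_⟩
  simp only [formalExp, PowerSeries.coeff_mk, LinearMap.sum_apply, LinearMap.smul_apply]
  exact Finset.sum_eq_zero fun k _ => by
    rw [(annihilation_pow_lowers ε E k l w hw).2 hl, smul_zero]

/-- The summand of the coefficient of `x^d` that first lowers the degree by `l`. -/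
def oscTerm (ε : Fin 4 → ℂ) (E : Exponent) (d : ℤ) (l : ℕ) : Module.End ℂ Fock :=
  if 0 ≤ d + l then
    PowerSeries.coeff (d + l).toNat (formalExp (creationSeries ε E)) *
      PowerSeries.coeff l (formalExp (annihilationSeries ε E))
  else 0

theorem oscTerm_finite (ε : Fin 4 → ℂ) (E : Exponent) (d : ℤ) (f : Fock) :
    (Function.support fun l => oscTerm ε E d l f).Finite := by
  obtain ⟨w, hw⟩ := annihilation_finite ε E f
  refine (Set.finite_Iic w).subset fun l hl => ?_
  by_contra hlw
  refine hl ?_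
  change oscTerm ε E d l f = 0
  unfold oscTerm
  split_ifs
  · rw [Module.End.mul_apply, hw l (not_le.1 hlw), map_zero]
  · rfl

/-- The coefficient of `x^d` in
`:exp(∑_{n≠0} E_n a_n x^{-n}): = exp(∑_{n>0} E_{-n} a_{-n} xⁿ) exp(∑_{n>0} E_n a_n x^{-n})`;
on each state the sum over `l` is finite. -/
def oscMode (ε : Fin 4 → ℂ) (E : Exponent) (d : ℤ) : Module.End ℂ Fock where
  toFun f := ∑ᶠ l : ℕ, oscTerm ε E d l f
  map_add' f g := by
    simp only [map_add]
    exact finsum_add_distrib (oscTerm_finite ε E d f) (oscTerm_finite ε E d g)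
  map_smul' c f := by
    simp only [map_smul, RingHom.id_apply]
    exact (smul_finsum' c (oscTerm_finite ε E d f)).symm

/-- The zero modes act on functions `ψ(t, t̃)`: `t₀` and `t̃₀` by multiplication, `∂_t` by
differentiation, so that `e^{c ∂_t}` is the translation `t ↦ t + c`. -/
abbrev ZeroModes : Type := ℂ × ℂ → ℂ

/-- The normally ordered `e^{E_t t₀ + E_t̃ t̃₀} e^{E_∂ ∂_t}`. -/
def zeroMode (E : Exponent) : Module.End ℂ ZeroModes where
  toFun ψ := fun s => Complex.exp (E .t * s.1 + E .tTilde * s.2) * ψ (s.1 + E .dt, s.2)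
  map_add' ψ φ := by
    funext s
    simp [mul_add]
  map_smul' c ψ := by
    funext s
    simp only [Pi.smul_apply, smul_eq_mul, RingHom.id_apply]
    ring

/-- The full space of states. -/
abbrev State : Type := ZeroModes ⊗[ℂ] Fock

/-- The coefficient of `x^d` in the normally ordered exponential of the linear combination of
modes with coefficients `E`, each `a_n` being accompanied by `x^{-n}`. In particular
`:(:e^E:)(:e^{E'}:): = :e^{E + E'}:` and `:(:e^E:)⁻¹: = :e^{-E}:`. -/
def normalOrderedExp (ε : Fin 4 → ℂ) (E : Exponent) (d : ℤ) : Module.End ℂ State :=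
  TensorProduct.map (zeroMode E) (oscMode ε E d)

/-- The exponent of the root current `A(r x) = e^{t₀} :exp(∑_{n≠0} a_n (r x)^{-n}):`, `r ∈ ℂˣ`. -/
def exponentA (r : ℂˣ) : Exponent
  | .a n => ((r ^ (-n) : ℂˣ) : ℂ)
  | .t => 1
  | .tTilde => 0
  | .dt => 0

/-- The exponent of the D6 vertex operator
`W_ā(x) = x^{-log q_a t̃₀} e^{-log q_a log(-q_a) t̃₀} e^{-log q_a ∂_t}
  :exp(∑_{n≠0} w_{ā,n} x^{-n}):`, `w_{ā,n} = a_n / P_ā^{[-n]}`, with `log q_a = ε_a`; the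
number `L` is the value of `log x`. -/
def exponentW (ε : Fin 4 → ℂ) (a : Fin 4) (L : ℂ) : Exponent
  | .a n => 1 / P ε {a}ᶜ (-n)
  | .t => 0
  | .tTilde => -ε a * (L + Complex.log (-(q ε a : ℂ)))
  | .dt => -ε a

/-- The exponent of `Λ_{ā,π}(x) = :W_ā(x) ∏_{c ∈ π} A(χ_{ā,x}(c))⁻¹:`. -/
def exponentΛ (ε : Fin 4 → ℂ) (a : Fin 4) (L : ℂ) (π : PlanePartition) : Exponent :=
  exponentW ε a L - ∑ c ∈ π.cells, exponentA (boxWeight ε a c)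

/-- The coefficient of `x^d` of the D6 `qq`-character
`T_ā(x) = ∑_π 𝔮^{|π|} Z̃_ā[π] Λ_{ā,π}(x)`, a formal power series in `𝔮` with operator
coefficients; `L` is the value of `log x`, which enters only the zero modes. -/
def qqChar (ε : Fin 4 → ℂ) (a : Fin 4) (L : ℂ) (d : ℤ) : PowerSeries (Module.End ℂ State) :=
  PowerSeries.mk fun k =>
    ∑ π : {π : PlanePartition // π.size = k},
      Z7 ε a π.1 • normalOrderedExp ε (exponentΛ ε a L π.1) d

/-- The vacuum `|0⟩`: `a_n |0⟩ = 0` for `n > 0` and `∂_t |0⟩ = 0`. -/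
def ket : State := (fun _ => 1) ⊗ₜ[ℂ] 1

/-- The dual vacuum `⟨0|`: `⟨0| a_{-n} = 0` for `n > 0`, `⟨0| t₀ = ⟨0| t̃₀ = 0` and
`⟨0|0⟩ = 1`. -/
def bra : State →ₗ[ℂ] ℂ :=
  (TensorProduct.lid ℂ ℂ).toLinearMap ∘ₗ
    TensorProduct.map (LinearMap.proj (0, 0)) (MvPolynomial.lcoeff ℂ 0)

/-- The vacuum expectation value `⟨0| O |0⟩`. -/
def vev (O : Module.End ℂ State) : ℂ := bra (O ket)

section Correlator

variable {ι : Type} [LinearOrder ι] [Fintype ι]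

/-- The coefficient of `∏_i v_i^{d_i}` in `⟨0| ∏_i T_{ā_i}(v_i) |0⟩`, a formal power series in
`𝔮`. The product is the composition of operators, with larger indices to the left. -/
def correlator (ε : Fin 4 → ℂ) (face : ι → Fin 4) (L : ι → ℂ) (d : ι → ℤ) : PowerSeries ℂ :=
  PowerSeries.mk fun k => vev (PowerSeries.coeff k
    (((Finset.univ : Finset ι).sort (· ≥ ·)).map fun i => qqChar ε (face i) (L i) (d i)).prod)

/-- `F ∈ SpectralField ι [[𝔮]]` is the expansion of the formal distribution
`⟨0| ∏_i T_{ā_i}(v_i) |0⟩`: all their coefficients agree. -/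
def IsCorrelator (ε : Fin 4 → ℂ) (face : ι → Fin 4) (L : ι → ℂ)
    (F : PowerSeries (SpectralField ι)) : Prop :=
  ∀ (k : ℕ) (d : ι → ℤ),
    (PowerSeries.coeff k F).coeff (toLex d) = PowerSeries.coeff k (correlator ε face L d)

end Correlator

end GaugeOrigami

end

open GaugeOrigami

/-! The identity holds separately for each tuple of plane partitions. The coefficient of `𝔮^k` on
the operator side is a finite sum over such tuples (`coeff_correlator`). Each term is the product of
the given coefficients `Z7` with the vacuum expectation value of a product of normally ordered
exponentials `Λ`. Normal ordering excludes self-contractions, so what remains to prove is that this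
expectation value is a product over pairs `i < j` of explicit functions of `v_i / v_j`.

The factorization is Wick's theorem (`vev_normalOrderedExp_prod`, with oscillator part
`coeff_pairProduct`). The rightmost vertex operator acts on the vacuum as a pure creation
exponential. Moving it to the left through another vertex operator costs a scalar power series in
the ratio of the two positions, the `contraction` (`oscMode_mul_creationCoeff`), and the dual vacuum
finally absorbs it. For `i < j` the ratio `v_i / v_j` has positive order in the lexicographic Hahn
series field, so these power series can be evaluated there and the two sides compared monomial by
monomial. The exchange rule `annihilation_mul_creation` is obtained from uniqueness for the equation
`x Y' = H Y` (`euler_eq_mul_unique`): both orderings solve the same equation with the same initial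
value.

For a single pair, the logarithm of the contraction is bilinear in the exponents, and the exponent
of `Λ` is that of `W` minus a sum of exponents of `A`. The contraction therefore splits into
`W`-`W`, `A`-`W`, `W`-`A` and `A`-`A` parts. The first is the one-loop factor; the others are
rational, because after cancellation the modes are finite sums of `n`-th powers, that is, expansions
of `log (1 - w x)`. The zero modes add one factor `q_b` for every box of the first partition.
Together these give `pairZ` (`eval_contraction_Λ`). The condition `∑ ε = 0` enters through
`P_univ_neg` and `P_univ_eq`; genericity makes the denominators `P_S^{[n]}` nonzero. -/

noncomputable section

namespace GaugeOrigami

open PowerSeries Finset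

/-! ### The Euler operator and formal exponentials -/

section FormalExp

variable {R : Type*} [Ring R]

/-- The Euler operator `x d/dx` on formal power series. -/
def euler : PowerSeries R →+ PowerSeries R where
  toFun f := PowerSeries.mk fun n => n • coeff n f
  map_zero' := by ext n; simp
  map_add' f g := by ext n; simp

@[simp]
theorem coeff_euler (n : ℕ) (f : PowerSeries R) : coeff n (euler f) = n • coeff n f := by
  simp [euler]

theorem euler_mul (f g : PowerSeries R) : euler (f * g) = euler f * g + f * euler g := by
  ext n
  rw [coeff_euler, map_add, coeff_mul, coeff_mul, coeff_mul, smul_sum, ← sum_add_distrib]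
  refine sum_congr rfl fun p hp => ?_
  rw [coeff_euler, coeff_euler, ← mem_antidiagonal.1 hp, add_smul, smul_mul_assoc,
    mul_smul_comm]

theorem euler_C (r : R) : euler (C r) = 0 := by
  ext n
  rcases n with _ | n <;> simp [coeff_C]

theorem euler_one : euler (1 : PowerSeries R) = 0 := by
  simpa using euler_C (1 : R)

/-- A solution of the linear differential equation `x Y' = H Y` with `H(0) = 0` is determined by
its constant term. -/
theorem euler_eq_mul_unique [Algebra ℂ R] {H Y Y' : PowerSeries R} (hH : coeff 0 H = 0)
    (hY : euler Y = H * Y) (hY' : euler Y' = H * Y') (h0 : coeff 0 Y = coeff 0 Y') : Y = Y' := by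
  ext n
  induction n using Nat.strong_induction_on with
  | _ n ih =>
    rcases Nat.eq_zero_or_pos n with rfl | hn
    · exact h0
    have h1 := congrArg (coeff n) hY
    have h2 := congrArg (coeff n) hY'
    rw [coeff_euler, coeff_mul] at h1 h2
    have h3 : n • coeff n Y = n • coeff n Y' := by
      rw [h1, h2]
      refine sum_congr rfl fun p hp => ?_
      have hp' := mem_antidiagonal.1 hp
      rcases Nat.eq_zero_or_pos p.1 with h | h
      · rw [h, hH, zero_mul, zero_mul]
      · rw [ih p.2 (by omega)]
    have h4 : (n : ℂ) • coeff n Y = (n : ℂ) • coeff n Y' := by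
      rw [Nat.cast_smul_eq_nsmul, Nat.cast_smul_eq_nsmul, h3]
    have h5 := congrArg (fun z => (n : ℂ)⁻¹ • z) h4
    simpa [smul_smul, hn.ne'] using h5

theorem coeff_pow_eq_zero {f : PowerSeries R} (h0 : coeff 0 f = 0) {k n : ℕ} (h : n < k) :
    coeff n (f ^ k) = 0 := by
  induction k generalizing n with
  | zero => omega
  | succ k ih =>
    rw [pow_succ, coeff_mul]
    refine sum_eq_zero fun p hp => ?_
    have hp' := mem_antidiagonal.1 hp
    rcases Nat.eq_zero_or_pos p.2 with h' | h'
    · rw [h', h0, mul_zero]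
    · rw [ih (by omega), zero_mul]

theorem euler_pow_succ {f : PowerSeries R} (hf : Commute f (euler f)) (k : ℕ) :
    euler (f ^ (k + 1)) = (k + 1) • (euler f * f ^ k) := by
  induction k with
  | zero => simp
  | succ k ih =>
    rw [pow_succ, euler_mul, ih, smul_mul_assoc, mul_assoc, ← pow_succ,
      (hf.pow_left (k + 1)).eq, ← succ_nsmul]

theorem commute_of_coeff {f g : PowerSeries R} (h : ∀ i j, Commute (coeff i f) (coeff j g)) :
    Commute f g := by
  change f * g = g * f
  ext n
  rw [coeff_mul, coeff_mul, ← Finset.Nat.sum_antidiagonal_swap]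
  exact sum_congr rfl fun p _ => (h p.2 p.1).eq

theorem commute_euler {f : PowerSeries R} (hf : ∀ i j, Commute (coeff i f) (coeff j f)) :
    Commute f (euler f) :=
  commute_of_coeff fun i j => by
    rw [coeff_euler]
    exact (hf i j).smul_right j

theorem monomial_eq_C_mul_X_pow (n : ℕ) (r : R) : monomial n r = C r * X ^ n := by
  ext m
  rw [coeff_C_mul, coeff_X_pow, coeff_monomial]
  simp

theorem coeff_monomial_mul (l n : ℕ) (r : R) (f : PowerSeries R) :
    coeff l (monomial n r * f) = if n ≤ l then r * coeff (l - n) f else 0 := by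
  rw [monomial_eq_C_mul_X_pow, mul_assoc, coeff_C_mul, coeff_X_pow_mul']
  split_ifs <;> simp

variable [Algebra ℂ R]

/-- Since `f ^ k` starts in degree `k`, the truncation order of the exponential may be enlarged
freely. -/
theorem coeff_formalExp {f : PowerSeries R} (h0 : coeff 0 f = 0) {n N : ℕ} (h : n ≤ N) :
    coeff n (formalExp f) =
      ∑ k ∈ range (N + 1), ((k.factorial : ℂ)⁻¹) • coeff n (f ^ k) := by
  rw [formalExp, coeff_mk]
  refine sum_subset (range_mono (by omega)) fun k _ hk => ?_
  rw [coeff_pow_eq_zero h0 (by simpa using hk), smul_zero]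

@[simp]
theorem coeff_zero_formalExp (f : PowerSeries R) : coeff 0 (formalExp f) = 1 := by
  rw [formalExp, coeff_mk]
  simp

/-- The coefficients of `f` must commute with each other, otherwise `x d/dx` of `f ^ k` is not `k`
times `euler f * f ^ (k - 1)`. -/
theorem euler_formalExp {f : PowerSeries R} (h0 : coeff 0 f = 0)
    (hf : ∀ i j, Commute (coeff i f) (coeff j f)) :
    euler (formalExp f) = euler f * formalExp f := by
  ext n
  rw [coeff_euler, coeff_formalExp h0 le_rfl, sum_range_succ', smul_add, smul_sum]
  have hz : n • (((Nat.factorial 0 : ℕ) : ℂ)⁻¹ • coeff n (f ^ 0)) = 0 := by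
    rcases n with _ | n <;> simp [coeff_one]
  rw [hz, add_zero, coeff_mul]
  have h1 : ∀ k ∈ range n, n • ((((k + 1).factorial : ℕ) : ℂ)⁻¹ • coeff n (f ^ (k + 1))) =
      ∑ p ∈ antidiagonal n, coeff p.1 (euler f) *
        (((k.factorial : ℂ)⁻¹) • coeff p.2 (f ^ k)) := by
    intro k _
    rw [smul_comm, ← coeff_euler, euler_pow_succ (commute_euler hf), map_nsmul, coeff_mul,
      ← Nat.cast_smul_eq_nsmul ℂ, smul_smul, smul_sum]
    refine sum_congr rfl fun p _ => ?_
    rw [mul_smul_comm, Nat.factorial_succ]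
    congr 1
    have : ((k : ℂ) + 1) ≠ 0 := Nat.cast_add_one_ne_zero k
    push_cast
    field_simp
  rw [sum_congr rfl h1, sum_comm]
  refine sum_congr rfl fun p hp => ?_
  have hp' := mem_antidiagonal.1 hp
  -- The term with `p.1 = 0` vanishes because `euler f` has no constant term. Otherwise `p.2 ≤ n -
  -- 1`, and the `n` available powers already give the full coefficient of the exponential.
  rcases Nat.eq_zero_or_pos p.1 with h | h
  · simp [h]
  · rw [← mul_sum, coeff_formalExp h0 (N := n - 1) (by omega), Nat.sub_add_cancel (by omega)]

/-- This characterization by a differential equation replaces manipulation of the exponential series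
in the functional equation and in the logarithm below. -/
theorem formalExp_unique {f Y : PowerSeries R} (h0 : coeff 0 f = 0)
    (hf : ∀ i j, Commute (coeff i f) (coeff j f)) (hY0 : coeff 0 Y = 1)
    (hY : euler Y = euler f * Y) : formalExp f = Y :=
  euler_eq_mul_unique (by simp) (euler_formalExp h0 hf) hY (by simp [hY0])

end FormalExp

/-! ### Functional equation of the exponential, and the logarithm of `1 - w x` -/

section FormalExpComm

variable {R : Type*} [CommRing R] [Algebra ℂ R]

theorem formalExp_add {f g : PowerSeries R} (hf : coeff 0 f = 0) (hg : coeff 0 g = 0) :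
    formalExp (f + g) = formalExp f * formalExp g := by
  refine formalExp_unique (by rw [map_add, hf, hg, add_zero]) (fun _ _ => Commute.all _ _)
    ?_ ?_
  · rw [coeff_mul]
    simp
  · rw [euler_mul, euler_formalExp hf fun _ _ => Commute.all _ _,
      euler_formalExp hg fun _ _ => Commute.all _ _, map_add]
    ring

theorem formalExp_zero : formalExp (0 : PowerSeries R) = 1 :=
  formalExp_unique (by simp) (fun _ _ => Commute.all _ _) (by simp) (by simp [euler_one])

theorem formalExp_sum {α : Type*} (s : Finset α) (f : α → PowerSeries R)
    (hf : ∀ a ∈ s, coeff 0 (f a) = 0) :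
    formalExp (∑ a ∈ s, f a) = ∏ a ∈ s, formalExp (f a) := by
  classical
  induction s using Finset.induction_on with
  | empty => simp [formalExp_zero]
  | insert a s ha ih =>
    rw [sum_insert ha, prod_insert ha, ← ih fun b hb => hf b (mem_insert_of_mem hb),
      formalExp_add (hf a (mem_insert_self _ _))]
    rw [map_sum]
    exact sum_eq_zero fun b hb => hf b (mem_insert_of_mem hb)

theorem formalExp_neg_mul {f : PowerSeries R} (hf : coeff 0 f = 0) :
    formalExp (-f) * formalExp f = 1 := by
  rw [← formalExp_add (by rw [map_neg, hf, neg_zero]) hf, neg_add_cancel, formalExp_zero]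

/-- `exp (- ∑_{n>0} (w x)ⁿ / n) = 1 - w x`. -/
theorem formalExp_log (w : ℂ) :
    formalExp (PowerSeries.mk fun n : ℕ => -(1 / (n : ℂ)) * w ^ n) = 1 - C w * X := by
  refine formalExp_unique (by simp) (fun _ _ => Commute.all _ _) (by simp) ?_
  ext n
  rw [coeff_euler, mul_sub, map_sub, map_sub, smul_sub, mul_one, ← mul_assoc, mul_comm _ (C w),
    mul_assoc, coeff_C_mul, coeff_C_mul, coeff_euler, coeff_mk]
  rcases n with _ | n
  · simp [-coeff_zero_eq_constantCoeff, coeff_zero_mul_X]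
  rw [coeff_succ_mul_X, coeff_euler, coeff_mk, coeff_X]
  have h1 : ((n : ℂ) + 1) ≠ 0 := Nat.cast_add_one_ne_zero n
  rcases n with _ | n
  · simp [coeff_one]
  · have h2 : ((n : ℂ) + 1 + 1) ≠ 0 := by exact_mod_cast (Nat.succ_ne_zero (n + 1))
    have h3 : ((n : ℂ) + 1) ≠ 0 := Nat.cast_add_one_ne_zero n
    simp only [nsmul_eq_mul, coeff_one]
    push_cast
    field_simp
    ring

end FormalExpComm

/-! ### Commutation of vertex operators -/

section Oscillators

variable (ε : Fin 4 → ℂ)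

theorem heis_neg_succ (m : ℕ) :
    heis ε (-((m + 1 : ℕ) : ℤ)) = LinearMap.mulLeft ℂ (MvPolynomial.X m.succPNat) := rfl

theorem heis_succ (m : ℕ) :
    heis ε ((m + 1 : ℕ) : ℤ) = (-(1 / ((m : ℂ) + 1)) * P ε univ (m + 1)) •
        (MvPolynomial.pderiv (R := ℂ) m.succPNat).toLinearMap := rfl

theorem heis_zero : heis ε 0 = 0 := rfl

/-- `[a_n, a_{-m}] = -(1/n) P_{1234}^{[n]} δ_{n,m}` for `n, m ≥ 0`. -/
theorem heis_comm (n m : ℕ) :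
    heis ε n * heis ε (-(m : ℤ)) = heis ε (-(m : ℤ)) * heis ε n +
      if n = m then algebraMap ℂ _ (-(1 / (n : ℂ)) * P ε univ n) else 0 := by
  -- At `n = m = 0` there is no oscillator, and the scalar vanishes too because `1 / 0 = 0`.
  rcases n with _ | n
  · rw [Nat.cast_zero, heis_zero]
    simp
  rcases m with _ | m
  · rw [Nat.cast_zero, neg_zero, heis_zero]
    simp
  rw [heis_neg_succ, heis_succ]
  refine LinearMap.ext fun f => ?_
  by_cases h : n = m
  · subst h
    simp [MvPolynomial.smul_eq_C_mul, Module.algebraMap_end_apply]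
    ring
  · have h' : n.succPNat ≠ m.succPNat := fun e => h (Nat.succPNat_injective e)
    simp [h, MvPolynomial.pderiv_X_of_ne h'.symm, MvPolynomial.smul_eq_C_mul]

theorem commute_creation (n m : ℕ) : Commute (heis ε (-(n : ℤ))) (heis ε (-(m : ℤ))) := by
  rcases n with _ | n
  · rw [Nat.cast_zero, neg_zero, heis_zero]
    exact Commute.zero_left _
  rcases m with _ | m
  · rw [Nat.cast_zero, neg_zero, heis_zero]
    exact Commute.zero_right _
  rw [heis_neg_succ, heis_neg_succ]
  refine LinearMap.ext fun f => ?_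
  simp only [Module.End.mul_apply, LinearMap.mulLeft_apply]
  ring

theorem commute_annihilation (n m : ℕ) : Commute (heis ε (n : ℤ)) (heis ε (m : ℤ)) := by
  rcases n with _ | n
  · rw [Nat.cast_zero, heis_zero]
    exact Commute.zero_left _
  rcases m with _ | m
  · rw [Nat.cast_zero, heis_zero]
    exact Commute.zero_right _
  rw [heis_succ, heis_succ]
  refine Commute.smul_left (Commute.smul_right ?_ _) _
  refine LinearMap.ext fun f => ?_
  -- The commutator of two derivations is a derivation, so it suffices that it kills the variables.
  have h : ⁅MvPolynomial.pderiv (R := ℂ) n.succPNat, MvPolynomial.pderiv (R := ℂ) m.succPNat⁆ = 0 := by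
    refine MvPolynomial.derivation_ext fun i => ?_
    rw [Derivation.commutator_apply]
    simp only [MvPolynomial.pderiv_X, Pi.single_apply]
    split_ifs <;> simp
  have h' := congrArg (fun D => D f) h
  simp only [Derivation.commutator_apply, Derivation.zero_apply] at h'
  exact sub_eq_zero.1 h'

/-! ### Exchange of annihilation and creation exponentials -/

variable (E E' : Exponent)

theorem commute_coeff_creationSeries (i j : ℕ) :
    Commute (coeff i (creationSeries ε E)) (coeff j (creationSeries ε E')) := by
  rw [creationSeries, creationSeries, coeff_mk, coeff_mk]
  exact ((commute_creation ε i j).smul_left _).smul_right _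

theorem commute_coeff_annihilationSeries (i j : ℕ) :
    Commute (coeff i (annihilationSeries ε E)) (coeff j (annihilationSeries ε E)) := by
  rw [annihilationSeries, coeff_mk, coeff_mk]
  exact ((commute_annihilation ε i j).smul_left _).smul_right _

theorem coeff_zero_creationSeries : coeff 0 (creationSeries ε E) = 0 := by
  rw [creationSeries, coeff_mk, Nat.cast_zero, neg_zero, heis_zero, smul_zero]

theorem coeff_zero_annihilationSeries : coeff 0 (annihilationSeries ε E) = 0 := by
  rw [annihilationSeries, coeff_mk, Nat.cast_zero, heis_zero, smul_zero]

/-- The coefficient of `xⁿ` in `exp(∑_{m>0} E_{-m} a_{-m} x^m)`. -/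
def creationCoeff (n : ℕ) : Module.End ℂ Fock := coeff n (formalExp (creationSeries ε E))

/-- The coefficient of `x^{-n}` in `exp(∑_{m>0} E_m a_m x^{-m})`. -/
def annihilationCoeff (n : ℕ) : Module.End ℂ Fock :=
  coeff n (formalExp (annihilationSeries ε E))

/-- The logarithm of the contraction of the vertex operators with exponents `E` (right) and `E'`
(left), as a power series in the ratio of their positions. -/
def contractionLog : PowerSeries ℂ :=
  PowerSeries.mk fun n : ℕ => -(1 / (n : ℂ)) * P ε univ n * (E (.a (-(n : ℤ))) * E' (.a (n : ℤ)))

/-- The contraction of two vertex operators. -/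
def contraction : PowerSeries ℂ := formalExp (contractionLog ε E E')

theorem coeff_zero_contractionLog : coeff 0 (contractionLog ε E E') = 0 := by
  rw [contractionLog, coeff_mk]
  simp

theorem euler_contraction :
    euler (contraction ε E E') = euler (contractionLog ε E E') * contraction ε E E' :=
  euler_formalExp (coeff_zero_contractionLog ε E E') fun _ _ => Commute.all _ _

theorem commute_pow_coeff {R : Type*} [Ring R] {f : PowerSeries R} {r : R}
    (h : ∀ n, Commute r (coeff n f)) (k n : ℕ) : Commute r (coeff n (f ^ k)) := by
  have hr : Commute (C r) f := commute_of_coeff fun i j => by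
    rw [coeff_C]
    split_ifs
    · exact h j
    · exact Commute.zero_left _
  have := congrArg (coeff n) (hr.pow_right k).eq
  rwa [coeff_C_mul, coeff_mul_C] at this

theorem commute_coeff_formalExp {R : Type*} [Ring R] [Algebra ℂ R] {f : PowerSeries R} {r : R}
    (h : ∀ n, Commute r (coeff n f)) (n : ℕ) : Commute r (coeff n (formalExp f)) := by
  rw [formalExp, coeff_mk]
  exact Commute.sum_right _ _ _ fun k _ => (commute_pow_coeff h k n).smul_right _

theorem commute_creationCoeff (n m : ℕ) :
    Commute (creationCoeff ε E n) (creationCoeff ε E' m) :=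
  commute_coeff_formalExp (fun j => (commute_coeff_formalExp (fun i =>
    (commute_coeff_creationSeries ε E E' i j).symm) n).symm) m

theorem commute_monomial_algebraMap {R : Type*} [Ring R] [Algebra ℂ R] (n : ℕ) (z : ℂ)
    (f : PowerSeries R) : Commute (monomial n (algebraMap ℂ R z)) f :=
  commute_of_coeff fun i j => by
    rw [coeff_monomial]
    split_ifs
    · exact Algebra.commutes z _
    · exact Commute.zero_left _

/-- `f(x y)` as a power series in `x` over `R⟦y⟧`. -/
def diagonalSeries (R : Type*) [Ring R] [Algebra ℂ R] (f : PowerSeries ℂ) :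
    PowerSeries (PowerSeries R) :=
  PowerSeries.mk fun n => monomial n (algebraMap ℂ R (coeff n f))

theorem coeff_diagonalSeries {R : Type*} [Ring R] [Algebra ℂ R] (f : PowerSeries ℂ) (n : ℕ) :
    coeff n (diagonalSeries R f) = monomial n (algebraMap ℂ R (coeff n f)) := by
  rw [diagonalSeries, coeff_mk]

theorem diagonalSeries_mul {R : Type*} [Ring R] [Algebra ℂ R] (f g : PowerSeries ℂ) :
    diagonalSeries R (f * g) = diagonalSeries R f * diagonalSeries R g := by
  refine PowerSeries.ext fun n => ?_
  rw [coeff_mul, coeff_diagonalSeries, coeff_mul, map_sum, map_sum]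
  refine sum_congr rfl fun p hp => ?_
  rw [coeff_diagonalSeries, coeff_diagonalSeries, monomial_mul_monomial, map_mul,
    mem_antidiagonal.1 hp]

theorem euler_diagonalSeries {R : Type*} [Ring R] [Algebra ℂ R] (f : PowerSeries ℂ) :
    euler (diagonalSeries R f) = diagonalSeries R (euler f) := by
  refine PowerSeries.ext fun n => ?_
  rw [coeff_euler, coeff_diagonalSeries, coeff_diagonalSeries, coeff_euler, map_nsmul, map_nsmul]

theorem commute_diagonalSeries {R : Type*} [Ring R] [Algebra ℂ R] (f : PowerSeries ℂ)
    (g : PowerSeries (PowerSeries R)) : Commute (diagonalSeries R f) g :=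
  commute_of_coeff fun i j => by
    rw [coeff_diagonalSeries]
    exact commute_monomial_algebraMap _ _ _

theorem euler_map {R S : Type*} [Ring R] [Ring S] (φ : R →+* S) (f : PowerSeries R) :
    euler (PowerSeries.map φ f) = PowerSeries.map φ (euler f) := by
  refine PowerSeries.ext fun n => ?_
  rw [coeff_euler, coeff_map, coeff_map, coeff_euler, map_nsmul]

/-- `A(y) a_{-m} = (a_{-m} + E_m [a_m, a_{-m}] y^m) A(y)` for `A(y) = exp(∑ E_n a_n yⁿ)`. -/
theorem annihilation_mul_heis (m : ℕ) :
    formalExp (annihilationSeries ε E) * C (heis ε (-(m : ℤ))) =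
      (C (heis ε (-(m : ℤ))) +
        monomial m (algebraMap ℂ _ (E (.a m) * (-(1 / (m : ℂ)) * P ε univ m)))) *
        formalExp (annihilationSeries ε E) := by
  set κ : ℂ := E (.a m) * (-(1 / (m : ℂ)) * P ε univ m) with hκ
  have hD := euler_formalExp (coeff_zero_annihilationSeries ε E)
    (commute_coeff_annihilationSeries ε E)
  set D := annihilationSeries ε E with hDdef
  -- The commutator of `euler D` with `a_{-m}` is a central monomial, already in the form `euler` of
  -- the correction term. Hence both sides of the claim solve `euler Y = euler D * Y`.
  have hcomm : euler D * C (heis ε (-(m : ℤ))) = C (heis ε (-(m : ℤ))) * euler D +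
      euler (monomial m (algebraMap ℂ (Module.End ℂ Fock) κ)) := by
    refine PowerSeries.ext fun n => ?_
    rw [coeff_mul_C, map_add, coeff_C_mul, coeff_euler, coeff_euler, coeff_monomial, hDdef,
      annihilationSeries, coeff_mk, smul_mul_assoc, smul_mul_assoc, heis_comm, mul_smul_comm,
      mul_smul_comm, smul_add, smul_add]
    congr 2
    split_ifs with h
    · subst h
      rw [Algebra.smul_def, ← map_mul]
    · rw [smul_zero]
  have hcent : Commute (euler D) (monomial m (algebraMap ℂ (Module.End ℂ Fock) κ)) :=
    (commute_monomial_algebraMap m κ _).symm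
  refine euler_eq_mul_unique (H := euler D) (by simp [-coeff_zero_eq_constantCoeff]) ?_ ?_ ?_
  · rw [euler_mul, euler_C, mul_zero, add_zero, hD, mul_assoc]
  · rw [euler_mul, map_add, euler_C, zero_add, hD, ← mul_assoc, ← mul_assoc, mul_add, hcomm,
      hcent.eq, ← add_mul]
    congr 1
    rw [add_mul]
    abel
  · have h0 : coeff 0 (monomial m (algebraMap ℂ (Module.End ℂ Fock) κ)) = 0 := by
      rw [coeff_monomial]
      split_ifs with h
      · rw [hκ, ← h]
        simp
      · rfl
    rw [coeff_mul_C, coeff_zero_formalExp, coeff_mul, Finset.Nat.antidiagonal_zero, sum_singleton, map_add,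
      h0, coeff_zero_formalExp, add_zero, coeff_zero_C, one_mul, mul_one]

/-- `A(y) c(x) = f(x y) c(x) A(y)`, where `f` is the contraction. -/
theorem annihilation_mul_creation :
    C (formalExp (annihilationSeries ε E')) * PowerSeries.map C (formalExp (creationSeries ε E)) =
      diagonalSeries _ (contraction ε E E') *
        (PowerSeries.map C (formalExp (creationSeries ε E)) *
          C (formalExp (annihilationSeries ε E'))) := by
  set A := formalExp (annihilationSeries ε E') with hA
  have hc := congrArg (PowerSeries.map C) (euler_formalExp (coeff_zero_creationSeries ε E)
    (commute_coeff_creationSeries ε E E))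
  rw [map_mul, ← euler_map] at hc
  set c := PowerSeries.map C (formalExp (creationSeries ε E)) with hcdef
  set G := PowerSeries.map (C (R := Module.End ℂ Fock)) (euler (creationSeries ε E)) with hG
  have hF := congrArg (diagonalSeries (Module.End ℂ Fock)) (euler_contraction ε E E')
  rw [← euler_diagonalSeries, diagonalSeries_mul] at hF
  set F := diagonalSeries (Module.End ℂ Fock) (contraction ε E E') with hFdef
  set K := diagonalSeries (Module.End ℂ Fock) (euler (contractionLog ε E E')) with hK
  -- This is the previous lemma in each degree of the outer variable `x`: the inner variable `y`
  -- carries `A`, and the commutators collect into a series in `x y`.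
  have hAG : C A * G = (G + K) * C A := by
    refine PowerSeries.ext fun n => ?_
    have h := annihilation_mul_heis ε E' n
    rw [← hA] at h
    have hz : n • (-(1 / (n : ℂ)) * P ε univ n * (E (.a (-(n : ℤ))) * E' (.a (n : ℤ)))) =
      (n • E (.a (-(n : ℤ)))) • (E' (.a n) * (-(1 / (n : ℂ)) * P ε univ n)) := by
      simp only [nsmul_eq_mul, smul_eq_mul]
      ring
    rw [coeff_C_mul, coeff_mul_C, map_add, hK, coeff_diagonalSeries, hG, coeff_map, coeff_euler,
      creationSeries, coeff_mk, coeff_euler, contractionLog, coeff_mk, hz, ← smul_assoc]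
    have e1 : ∀ (z : ℂ) (x : Module.End ℂ Fock), C (z • x) = z • C x := fun z x => by
      refine PowerSeries.ext fun n => ?_
      rw [coeff_smul, coeff_C, coeff_C]
      split_ifs <;> simp
    have e2 : ∀ z w : ℂ, monomial n (algebraMap ℂ (Module.End ℂ Fock) (z • w)) =
        z • monomial n (algebraMap ℂ (Module.End ℂ Fock) w) := fun z w => by
      refine PowerSeries.ext fun k => ?_
      rw [coeff_smul, coeff_monomial, coeff_monomial]
      split_ifs
      · rw [smul_eq_mul, map_mul, Algebra.smul_def]
      · rw [smul_zero]
    rw [e1, e2, mul_smul_comm, ← smul_add, smul_mul_assoc, h]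
  -- The Euler operator acts in `x` only, so `A(y)` is a constant for it. On the other side `F`
  -- contributes `K` and the creation exponential contributes `G`; `F` is central.
  refine euler_eq_mul_unique (H := G + K) ?_ ?_ ?_ ?_
  · rw [map_add, hG, hK, coeff_map, coeff_diagonalSeries, coeff_euler, coeff_euler, zero_smul,
      zero_smul, map_zero, map_zero, map_zero, add_zero]
  · rw [euler_mul, euler_C, zero_mul, zero_add, hc, ← mul_assoc, hAG, mul_assoc]
  · have hFG : G * F = F * G := (commute_diagonalSeries _ _).symm.eq
    rw [euler_mul, euler_mul, euler_C, mul_zero, add_zero, hc, hF, add_mul, mul_assoc K,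
      ← mul_assoc G, hFG, add_comm]
    simp only [mul_assoc]
  · rw [coeff_C_mul, coeff_mul, Finset.Nat.antidiagonal_zero, sum_singleton, coeff_mul_C, hcdef, coeff_map,
      hFdef, coeff_diagonalSeries, contraction, coeff_zero_formalExp, coeff_zero_formalExp]
    simp [monomial_eq_C_mul_X_pow]

theorem annihilationCoeff_mul_creationCoeff (l n : ℕ) :
    annihilationCoeff ε E' l * creationCoeff ε E n = ∑ p ∈ antidiagonal n,
      if p.1 ≤ l then coeff p.1 (contraction ε E E') •
        (creationCoeff ε E p.2 * annihilationCoeff ε E' (l - p.1)) else 0 := by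
  have h := congrArg (fun f => coeff l (coeff n f)) (annihilation_mul_creation ε E E')
  simp only [coeff_C_mul, coeff_map, coeff_mul_C] at h
  rw [annihilationCoeff, creationCoeff, h, coeff_mul, map_sum]
  refine sum_congr rfl fun p _ => ?_
  rw [coeff_diagonalSeries, coeff_monomial_mul, coeff_mul_C, coeff_map, coeff_C_mul,
    ← Algebra.smul_def]
  rfl

/-- The contraction removes `p` units from the annihilation degree `l` and adds them to `d`. The
creation degree `d + l` of the vertex operator, hence also the guard `0 ≤ d + l`, is unchanged. -/
theorem oscTerm_mul_creationCoeff (d : ℤ) (l n : ℕ) :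
    oscTerm ε E' d l * creationCoeff ε E n = ∑ p ∈ antidiagonal n,
      if p.1 ≤ l then coeff p.1 (contraction ε E E') •
        (creationCoeff ε E p.2 * oscTerm ε E' (d + p.1) (l - p.1)) else 0 := by
  unfold oscTerm
  split_ifs with h
  · change creationCoeff ε E' _ * annihilationCoeff ε E' _ * _ = _
    rw [mul_assoc, annihilationCoeff_mul_creationCoeff, mul_sum]
    refine sum_congr rfl fun p _ => ?_
    split_ifs with h1 h2
    · have e : (d + p.1 + ((l - p.1 : ℕ) : ℤ)) = d + l := by omega
      rw [e, mul_smul_comm, ← mul_assoc, (commute_creationCoeff ε E' E _ _).eq, mul_assoc]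
      rfl
    · omega
    · rw [mul_zero]
  · rw [zero_mul]
    refine (sum_eq_zero fun p _ => ?_).symm
    split_ifs with h1 h2
    · omega
    · rw [mul_zero, smul_zero]
    · rfl

theorem finsum_shift {M : Type*} [AddCommMonoid M] {h : ℕ → M} (hh : (Function.support h).Finite)
    (p : ℕ) : (Function.support fun l => if p ≤ l then h (l - p) else 0).Finite ∧
      (∑ᶠ l, if p ≤ l then h (l - p) else 0) = ∑ᶠ l, h l := by
  obtain ⟨N, hN⟩ := hh.bddAbove
  have h1 : ∀ l, N < l → h l = 0 := fun l hl => by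
    by_contra h0
    exact absurd (hN h0) (not_le.2 hl)
  have hs : (Function.support fun l => if p ≤ l then h (l - p) else 0) ⊆
      (range (p + (N + 1)) : Set ℕ) := fun l hl => by
    by_contra h0
    refine hl ?_
    simp only [coe_range, Set.mem_Iio] at h0
    change (if p ≤ l then h (l - p) else 0) = 0
    rw [if_pos (by omega), h1 _ (by omega)]
  refine ⟨(finite_toSet _).subset hs, ?_⟩
  rw [finsum_eq_sum_of_support_subset _ hs,
    finsum_eq_sum_of_support_subset (s := range (N + 1)) h fun l hl => ?_, sum_range_add,
    sum_eq_zero, zero_add]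
  · exact sum_congr rfl fun x _ => by simp
  · intro x hx
    rw [if_neg (by simpa using hx)]
  · simpa [Nat.lt_succ_iff] using hN hl

/-- Moving a creation operator to the left through a vertex operator. -/
theorem oscMode_mul_creationCoeff (d : ℤ) (n : ℕ) :
    oscMode ε E' d * creationCoeff ε E n = ∑ p ∈ antidiagonal n,
      coeff p.1 (contraction ε E E') • (creationCoeff ε E p.2 * oscMode ε E' (d + p.1)) := by
  refine LinearMap.ext fun g => ?_
  change ∑ᶠ l, (oscTerm ε E' d l * creationCoeff ε E n) g = _
  rw [LinearMap.sum_apply]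
  -- On the fixed state `g` each sum over `l` is finite, so it can be exchanged with the sum over
  -- `p` and reindexed by `l - p.1`.
  have key : ∀ p : ℕ × ℕ, (Function.support fun l => if p.1 ≤ l then
      (coeff p.1 (contraction ε E E') • creationCoeff ε E p.2)
        (oscTerm ε E' (d + p.1) (l - p.1) g) else 0).Finite ∧
      (∑ᶠ l, if p.1 ≤ l then (coeff p.1 (contraction ε E E') • creationCoeff ε E p.2)
        (oscTerm ε E' (d + p.1) (l - p.1) g) else 0) =
      (coeff p.1 (contraction ε E E') • (creationCoeff ε E p.2 * oscMode ε E' (d + p.1))) g := by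
    intro p
    have hfin := oscTerm_finite ε E' (d + p.1) g
    have h := finsum_shift (h := fun l => (coeff p.1 (contraction ε E E') •
      creationCoeff ε E p.2) (oscTerm ε E' (d + p.1) l g))
      (hfin.subset fun l hl h0 => hl (by
        change (coeff p.1 (contraction ε E E') • creationCoeff ε E p.2) _ = 0
        rw [show oscTerm ε E' (d + p.1) l g = 0 from h0, map_zero])) p.1
    refine ⟨h.1, h.2.trans ?_⟩
    exact (map_finsum (coeff p.1 (contraction ε E E') • creationCoeff ε E p.2) hfin).symm
  rw [← sum_congr rfl fun p _ => (key p).2, ← finsum_sum_comm _ _ fun p _ => (key p).1]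
  refine finsum_congr fun l => ?_
  rw [oscTerm_mul_creationCoeff, LinearMap.sum_apply]
  refine sum_congr rfl fun p _ => ?_
  split_ifs <;> rfl

/-! ### Action on the vacuum and on the dual vacuum -/

theorem annihilationCoeff_one (l : ℕ) :
    annihilationCoeff ε E l 1 = if l = 0 then 1 else 0 := by
  split_ifs with h
  · rw [h, annihilationCoeff, coeff_zero_formalExp, Module.End.one_apply]
  · have h1 : (1 : Fock) ∈ degreeLE 0 := by
      intro s hs
      have : s = 0 := by
        by_contra h0
        rw [MvPolynomial.mem_support_iff, MvPolynomial.coeff_one, if_neg (Ne.symm h0)] at hs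
        exact hs rfl
      simp [this]
    rw [annihilationCoeff, formalExp, coeff_mk, LinearMap.sum_apply]
    refine sum_eq_zero fun k _ => ?_
    rw [LinearMap.smul_apply, (annihilation_pow_lowers ε E k l 0 h1).2 (Nat.pos_of_ne_zero h),
      smul_zero]

theorem oscMode_one (d : ℤ) :
    oscMode ε E d 1 = if 0 ≤ d then creationCoeff ε E d.toNat 1 else 0 := by
  change ∑ᶠ l, oscTerm ε E d l 1 = _
  rw [finsum_eq_single _ 0]
  · unfold oscTerm
    simp only [Nat.cast_zero, add_zero]
    split_ifs
    · rw [Module.End.mul_apply, coeff_zero_formalExp]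
      rfl
    · rfl
  · intro l hl
    unfold oscTerm
    split_ifs
    · rw [Module.End.mul_apply]
      change DFunLike.coe _ (annihilationCoeff ε E l 1) = _
      rw [annihilationCoeff_one, if_neg hl, map_zero]
    · rfl

/-- The vacuum component of a Fock space state. -/
def vacuumCoeff : Fock →ₗ[ℂ] ℂ := MvPolynomial.lcoeff ℂ 0

theorem vacuumCoeff_heis_neg (m : ℕ) (f : Fock) : vacuumCoeff (heis ε (-(m : ℤ)) f) = 0 := by
  rcases m with _ | m
  · rw [Nat.cast_zero, neg_zero, heis_zero, LinearMap.zero_apply, map_zero]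
  · rw [heis_neg_succ, LinearMap.mulLeft_apply]
    change MvPolynomial.coeff 0 (MvPolynomial.X _ * f) = 0
    rw [MvPolynomial.coeff_X_mul', if_neg (by simp)]

/-- In positive degree every term has some `a_{-m}` as its leftmost factor, which the dual vacuum
annihilates. -/
theorem vacuumCoeff_creationCoeff (n : ℕ) (f : Fock) :
    vacuumCoeff (creationCoeff ε E n f) = if n = 0 then vacuumCoeff f else 0 := by
  split_ifs with h
  · rw [h, creationCoeff, coeff_zero_formalExp, Module.End.one_apply]
  · rw [creationCoeff, formalExp, coeff_mk, LinearMap.sum_apply, map_sum]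
    refine sum_eq_zero fun k _ => ?_
    rw [LinearMap.smul_apply, map_smul]
    rcases k with _ | k
    · simp [coeff_one, h]
    · rw [pow_succ', coeff_mul, LinearMap.sum_apply, map_sum, sum_eq_zero, smul_zero]
      intro p _
      rw [creationSeries, coeff_mk, smul_mul_assoc, LinearMap.smul_apply, map_smul,
        Module.End.mul_apply, vacuumCoeff_heis_neg, smul_zero]

end Oscillators

/-! ### Expansions in the ratios of the spectral parameters -/

/-- The product of the modes `x_i^{d_i}` of vertex operators. -/
def oscProd (ε : Fin 4 → ℂ) {ι : Type} (E : ι → Exponent) (d : ι → ℤ) (l : List ι) : Module.End ℂ Fock :=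
  (l.map fun i => oscMode ε (E i) (d i)).prod

theorem oscProd_congr (ε : Fin 4 → ℂ) {ι : Type} (E : ι → Exponent) {d d' : ι → ℤ} {l : List ι}
    (h : ∀ i ∈ l, d i = d' i) : oscProd ε E d l = oscProd ε E d' l := by
  rw [oscProd, oscProd]
  congr 1
  exact List.map_congr_left fun i hi => by rw [h i hi]

theorem prod_pairs_insert_min {ι M : Type*} [LinearOrder ι] [CommMonoid M] (g : ι → ι → M)
    {S : Finset ι} {a : ι} (ha : ∀ x ∈ S, a < x) :
    ∏ ij ∈ insert a S ×ˢ insert a S with ij.1 < ij.2, g ij.1 ij.2 =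
      (∏ j ∈ S, g a j) * ∏ ij ∈ S ×ˢ S with ij.1 < ij.2, g ij.1 ij.2 := by
  have haS : a ∉ S := fun h => lt_irrefl _ (ha a h)
  have h1 : (insert a S ×ˢ insert a S).filter (fun ij => ij.1 < ij.2) =
      (S.map ⟨fun j => (a, j), fun _ _ h => (Prod.ext_iff.1 h).2⟩).disjUnion
        ((S ×ˢ S).filter fun ij => ij.1 < ij.2) (by
          rw [disjoint_left]
          rintro ⟨x, y⟩ h h'
          obtain ⟨j, -, h⟩ := mem_map.1 h
          obtain rfl : a = x := congrArg Prod.fst h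
          simp [haS] at h') := by
    ext ⟨x, y⟩
    have hmap : (x, y) ∈ S.map ⟨fun j => (a, j), fun _ _ h => (Prod.ext_iff.1 h).2⟩ ↔
        x = a ∧ y ∈ S := by
      rw [mem_map]
      constructor
      · rintro ⟨j, hj, h⟩
        obtain ⟨rfl, rfl⟩ := Prod.ext_iff.1 h
        exact ⟨rfl, hj⟩
      · rintro ⟨rfl, hy⟩
        exact ⟨y, hy, rfl⟩
    rw [mem_disjUnion, hmap]
    simp only [mem_filter, mem_product, mem_insert]
    constructor
    · rintro ⟨⟨rfl | hx, rfl | hy⟩, h⟩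
      · exact absurd h (lt_irrefl _)
      · exact Or.inl ⟨rfl, hy⟩
      · exact absurd h (ha x hx).asymm
      · exact Or.inr ⟨⟨hx, hy⟩, h⟩
    · rintro (⟨rfl, hj⟩ | ⟨⟨hx, hy⟩, h⟩)
      · exact ⟨⟨Or.inl rfl, Or.inr hj⟩, ha _ hj⟩
      · exact ⟨⟨Or.inr hx, Or.inr hy⟩, h⟩
  rw [h1, prod_disjUnion, prod_map]
  rfl

theorem sort_insert_min {ι : Type} [LinearOrder ι] {S : Finset ι} {a : ι} (ha : ∀ x ∈ S, a < x) :
    (insert a S).sort (· ≥ ·) = S.sort (· ≥ ·) ++ [a] := by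
  have haS : a ∉ S := fun h => lt_irrefl _ (ha a h)
  refine List.Perm.eq_of_pairwise' (r := (· ≥ ·)) (Finset.pairwise_sort _ _) ?_ ?_
  · rw [List.pairwise_append]
    refine ⟨Finset.pairwise_sort _ _, List.pairwise_singleton _ _, fun x hx y hy => ?_⟩
    rw [List.mem_singleton.1 hy]
    exact (ha x ((Finset.mem_sort _).1 hx)).le
  · rw [List.perm_ext_iff_of_nodup (Finset.sort_nodup _ _)]
    · intro x
      simp [or_comm]
    · rw [List.nodup_append]
      refine ⟨Finset.sort_nodup _ _, List.nodup_singleton _, fun x hx y hy => ?_⟩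
      rw [List.mem_singleton.1 hy]
      exact (ha x ((Finset.mem_sort _).1 hx)).ne'

section Expansion

variable {ι : Type} [LinearOrder ι] [Fintype ι]

/-- The exponent of `v_i / v_j`. -/
def ratioExponent (i j : ι) : ι → ℤ := Pi.single i 1 - Pi.single j 1


theorem specVar_div (i j : ι) : (specVar i / specVar j : SpectralField ι) =
    HahnSeries.single (toLex (ratioExponent i j)) 1 := by
  rw [specVar, specVar, HahnSeries.single_div_single, div_one]
  rfl

theorem orderTop_specVar_div_pos {i j : ι} (h : i < j) :
    0 < (specVar i / specVar j : SpectralField ι).orderTop := by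
  rw [specVar_div, HahnSeries.orderTop_single one_ne_zero]
  refine WithTop.coe_pos.2 ?_
  refine ⟨i, fun k hk => ?_, ?_⟩
  · change (0 : ℤ) = (Pi.single i 1 - Pi.single j 1 : ι → ℤ) k
    simp [ne_of_lt hk, (lt_trans hk h).ne]
  · change (0 : ℤ) < (Pi.single i 1 - Pi.single j 1 : ι → ℤ) i
    simp [h.ne]

/-- Powers of `v_i / v_j` are single monomials, so multiplication by them only shifts exponents.
Positivity of the order makes the family of powers summable. -/
theorem coeff_heval_mul {i j : ι} (h : i < j) (f : PowerSeries ℂ) (G : SpectralField ι)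
    (d : ι → ℤ) :
    (heval (specVar i / specVar j) f * G).coeff (toLex d) =
      ∑ᶠ n : ℕ, coeff n f *
        G.coeff (toLex (d - (n : ℤ) • ratioExponent i j)) := by
  have hx := orderTop_specVar_div_pos h
  change ((HahnSeries.SummableFamily.powerSeriesFamily (specVar i / specVar j) f).hsum * G).coeff
    (toLex d) = _
  rw [mul_comm, ← HahnSeries.SummableFamily.hsum_smul, HahnSeries.SummableFamily.coeff_hsum]
  refine finsum_congr fun n => ?_
  have hn : (HahnSeries.SummableFamily.powerSeriesFamily (specVar i / specVar j) f) n =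
      HahnSeries.single (toLex ((n : ℤ) • ratioExponent i j)) (coeff n f) := by
    rw [HahnSeries.SummableFamily.powerSeriesFamily_of_orderTop_pos hx, specVar_div,
      HahnSeries.single_pow, one_pow, ← HahnSeries.single_zero_mul_eq_smul,
      HahnSeries.single_mul_single, zero_add, mul_one, natCast_zsmul]
    rfl
  rw [HahnSeries.SummableFamily.smul_apply, hn, HahnSeries.of_symm_smul_of_eq_mul, mul_comm,
    HahnSeries.coeff_single_mul]
  rfl

/-- The product `∏_{i<j} f_{ij}(v_i / v_j)` over a set of branes. -/
def pairProduct (f : ι → ι → PowerSeries ℂ) (S : Finset ι) : SpectralField ι :=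
  ∏ ij ∈ S ×ˢ S with ij.1 < ij.2, heval (specVar ij.1 / specVar ij.2) (f ij.1 ij.2)

theorem pairProduct_insert (f : ι → ι → PowerSeries ℂ) {S : Finset ι} {a : ι}
    (ha : ∀ x ∈ S, a < x) : pairProduct f (insert a S) =
      (∏ j ∈ S, heval (specVar a / specVar j) (f a j)) * pairProduct f S :=
  prod_pairs_insert_min (fun i j => heval (specVar i / specVar j) (f i j)) ha

/-- This interpolates along the path of the creation exponential of `a`: it has crossed the
operators in `l₂`, while those in `l₁` are still to be crossed and account for the remaining
contraction factors. With `l₂` empty it is the induction step of Wick's theorem. -/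
theorem coeff_pairProduct_aux (ε : Fin 4 → ℂ) (E : ι → Exponent) {S : Finset ι} {a : ι}
    (haS : ∀ x ∈ S, a < x) (f : ι → PowerSeries ℂ)
    (hf : ∀ j ∈ S, f j = contraction ε (E a) (E j)) (H : SpectralField ι)
    (hH : ∀ d : ι → ℤ, H.coeff (toLex d) = if ∀ i, i ∉ S → d i = 0 then
      vacuumCoeff (oscProd ε E d (S.sort (· ≥ ·)) 1) else 0)
    (l₁ l₂ : List ι) (hl : l₁ ++ l₂ = S.sort (· ≥ ·)) (d : ι → ℤ) :
    ((l₁.map fun j => heval (specVar a / specVar j) (f j)).prod * H).coeff (toLex d) =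
      if (∀ i, i ∉ insert a S → d i = 0) ∧ 0 ≤ d a then
        vacuumCoeff ((oscProd ε E d l₁ * creationCoeff ε (E a) (d a).toNat * oscProd ε E d l₂) 1)
      else 0 := by
  have ha : a ∉ S := fun h => lt_irrefl _ (haS a h)
  have hnd : (l₁ ++ l₂).Nodup := hl ▸ Finset.sort_nodup _ _
  have hmem : ∀ x ∈ l₁ ++ l₂, x ∈ S := fun x hx => (Finset.mem_sort (· ≥ ·)).1 (hl ▸ hx)
  -- Passing the last entry `j` of `l₁` to `l₂` is one crossing. The exponents `d` must vary, since
  -- a crossing transfers powers from `v_a` to `v_j`. For empty `l₁` the dual vacuum leaves only `d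
  -- a = 0`.
  induction l₁ using List.reverseRecOn generalizing l₂ d with
  | nil =>
    rw [List.nil_append] at hl
    rw [List.map_nil, List.prod_nil, one_mul, hH, hl,
      show oscProd ε E d [] = 1 from rfl, one_mul, Module.End.mul_apply, vacuumCoeff_creationCoeff]
    by_cases h1 : ∀ i, i ∉ S → d i = 0
    · rw [if_pos h1, if_pos ⟨fun i hi => h1 i fun h => hi (mem_insert_of_mem h), (h1 a ha).ge⟩,
        if_pos (by rw [h1 a ha]; rfl)]
    · rw [if_neg h1]
      split_ifs with h2 h3
      · refine absurd (fun i hi => ?_) h1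
        by_cases hia : i = a
        · rw [hia]
          omega
        · exact h2.1 i fun h => (mem_insert.1 h).elim hia hi
      · rfl
      · rfl
  | append_singleton l₁ j ih =>
    have hj : j ∈ S := hmem j (by simp)
    have hja : j ≠ a := fun h => ha (h ▸ hj)
    have hjl₁ : j ∉ l₁ := fun h => by
      rw [List.append_assoc, List.nodup_append] at hnd
      exact hnd.2.2 j h j (by simp) rfl
    have hjl₂ : j ∉ l₂ := fun h => by
      rw [List.nodup_append] at hnd
      exact hnd.2.2 j (by simp) j h rfl
    have hal₁ : a ∉ l₁ := fun h => ha (hmem a (by simp [h]))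
    have hal₂ : a ∉ l₂ := fun h => ha (hmem a (by simp [h]))
    have hl' : l₁ ++ j :: l₂ = S.sort (· ≥ ·) := by rw [← hl]; simp
    have hdn : ∀ n : ℕ, ((d - (n : ℤ) • ratioExponent a j) a = d a - n) ∧
        ((d - (n : ℤ) • ratioExponent a j) j = d j + n) ∧
        ∀ i, i ≠ a → i ≠ j → (d - (n : ℤ) • ratioExponent a j) i = d i := by
      intro n
      refine ⟨?_, ?_, fun i h1 h2 => ?_⟩
      · simp [ratioExponent, hja.symm]
      · simp [ratioExponent, hja]
      · simp [ratioExponent, h1, h2]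
    have hIH := fun n : ℕ => ih (j :: l₂) hl' (d - (n : ℤ) • ratioExponent a j)
      (hl' ▸ Finset.sort_nodup _ _) fun x hx => (Finset.mem_sort (· ≥ ·)).1 (hl' ▸ hx)
    have hcond : ∀ n : ℕ, ((∀ i, i ∉ insert a S →
        (d - (n : ℤ) • ratioExponent a j) i = 0) ∧
        0 ≤ (d - (n : ℤ) • ratioExponent a j) a) ↔
        ((∀ i, i ∉ insert a S → d i = 0) ∧ (n : ℤ) ≤ d a) := by
      intro n
      rw [(hdn n).1, sub_nonneg]
      refine and_congr_left fun _ => forall_congr' fun i => imp_congr_right fun hi => ?_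
      rw [(hdn n).2.2 i (fun h => hi (h ▸ mem_insert_self _ _))
        (fun h => hi (h ▸ mem_insert_of_mem hj))]
    rw [List.map_append, List.prod_append, List.map_singleton, List.prod_singleton,
      mul_comm (List.prod _), mul_assoc, coeff_heval_mul (haS j hj)]
    by_cases h : (∀ i, i ∉ insert a S → d i = 0) ∧ 0 ≤ d a
    · rw [if_pos h]
      obtain ⟨n, hn⟩ := Int.eq_ofNat_of_zero_le h.2
      -- The contraction of order `m` lowers the exponent of `v_a` to `d a - m`, and a creation
      -- exponential has no negative degrees. The surviving orders are those of the antidiagonal in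
      -- `oscMode_mul_creationCoeff`.
      rw [finsum_eq_sum_of_support_subset (s := range (n + 1))]
      · have e : oscProd ε E d (l₁ ++ [j]) =
            oscProd ε E d l₁ * oscMode ε (E j) (d j) := by
          simp [oscProd]
        rw [e, mul_assoc (oscProd ε E d l₁), hn, Int.toNat_natCast, oscMode_mul_creationCoeff,
          mul_sum, sum_mul, LinearMap.sum_apply, map_sum, Finset.Nat.sum_antidiagonal_eq_sum_range_succ_mk]
        refine sum_congr rfl fun m hm => ?_
        have hm' := mem_range.1 hm
        rw [hIH, if_pos ((hcond m).2 ⟨h.1, by omega⟩)]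
        have e1 : oscProd ε E (d - (m : ℤ) • ratioExponent a j) (j :: l₂) =
            oscMode ε (E j) (d j + m) * oscProd ε E d l₂ := by
          rw [oscProd, List.map_cons, List.prod_cons, (hdn m).2.1]
          congr 1
          exact oscProd_congr _ _ fun i hi => (hdn m).2.2 i (fun h => hal₂ (h ▸ hi))
            (fun h => hjl₂ (h ▸ hi))
        have e2 : oscProd ε E (d - (m : ℤ) • ratioExponent a j) l₁ =
            oscProd ε E d l₁ :=
          oscProd_congr _ _ fun i hi => (hdn m).2.2 i (fun h => hal₁ (h ▸ hi))
            (fun h => hjl₁ (h ▸ hi))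
        have e3 : (d a - m).toNat = n - m := by omega
        rw [e1, e2, (hdn m).1, e3, mul_smul_comm, smul_mul_assoc, LinearMap.smul_apply, map_smul,
          smul_eq_mul, hf j hj]
        simp only [mul_assoc]
      · intro m hm
        by_contra h0
        refine hm ?_
        change _ * _ = _
        simp only [coe_range, Set.mem_Iio] at h0
        rw [hIH, if_neg, mul_zero]
        rw [hcond]
        omega
    · rw [if_neg h]
      refine finsum_eq_zero_of_forall_eq_zero fun n => ?_
      rw [hIH, if_neg, mul_zero]
      rw [hcond]
      exact fun h' => h ⟨h'.1, by omega⟩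

/-- Wick's theorem: the coefficients of a vacuum expectation value of vertex operators. -/
theorem coeff_pairProduct (ε : Fin 4 → ℂ) (E : ι → Exponent) (S : Finset ι) (d : ι → ℤ) :
    (pairProduct (fun i j => contraction ε (E i) (E j)) S).coeff (toLex d) =
      if ∀ i, i ∉ S → d i = 0 then vacuumCoeff (oscProd ε E d (S.sort (· ≥ ·)) 1) else 0 := by
  induction S using Finset.induction_on_min generalizing d with
  | empty =>
    have h1 : vacuumCoeff (1 : Fock) = 1 := by
      change MvPolynomial.coeff 0 (1 : Fock) = 1
      simp
    have h2 : (∀ i, i ∉ (∅ : Finset ι) → d i = 0) ↔ toLex d = 0 := by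
      constructor
      · exact fun h => congrArg toLex (funext fun i => h i (notMem_empty i))
      · exact fun h i _ => congrFun (toLex.injective h) i
    rw [pairProduct, show (∅ ×ˢ ∅ : Finset (ι × ι)) = ∅ from rfl, filter_empty, prod_empty,
      sort_empty, show oscProd ε E d [] = 1 from rfl, Module.End.one_apply,
      h1]
    by_cases h : toLex d = 0
    · rw [if_pos (h2.2 h), h, HahnSeries.coeff_one, if_pos rfl]
    · rw [if_neg (h2.not.2 h), HahnSeries.coeff_one, if_neg h]
  | insert a S ha ih =>
    rw [pairProduct_insert _ ha, sort_insert_min ha]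
    have h := coeff_pairProduct_aux ε E ha (fun j => contraction ε (E a) (E j))
      (fun _ _ => rfl) _ ih (S.sort (· ≥ ·)) [] (List.append_nil _) d
    rw [← List.prod_toFinset _ (Finset.sort_nodup _ _), Finset.sort_toFinset] at h
    rw [h]
    have e : oscProd ε E d (S.sort (· ≥ ·) ++ [a]) =
        oscProd ε E d (S.sort (· ≥ ·)) * oscMode ε (E a) (d a) := by
      simp [oscProd]
    have e' : oscProd ε E d [] = 1 := rfl
    rw [e, e', mul_one, Module.End.mul_apply, Module.End.mul_apply, oscMode_one]
    by_cases h2 : 0 ≤ d a <;> simp [h2]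

end Expansion

/-! ### Correlators as sums over plane partitions -/

section ListProducts

theorem list_prod_map_smul {ι R : Type*} [Ring R] [Algebra ℂ R] (z : ι → ℂ) (A : ι → R)
    (l : List ι) : (l.map fun i => z i • A i).prod = (l.map z).prod • (l.map A).prod := by
  induction l with
  | nil => simp
  | cons i l ih => simp [ih, smul_smul, mul_comm]

theorem list_prod_map_monomial {ι R : Type*} [Ring R] (s : ι → ℕ) (A : ι → R) (l : List ι) :
    (l.map fun i => monomial (s i) (A i)).prod =
      monomial (l.map s).sum (l.map A).prod := by
  induction l with
  | nil => simp
  | cons i l ih => simp [ih, monomial_mul_monomial]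

/-- Products along a list without repetitions are multilinear. -/
def listProdMultilinear {ι : Type*} (R : Type*) [Ring R] (l : List ι) (hl : l.Nodup)
    (hmem : ∀ i, i ∈ l) : MultilinearMap ℕ (fun _ : ι => R) R where
  toFun m := (l.map m).prod
  map_update_add' m i x y := by
    obtain ⟨l₁, l₂, rfl⟩ := List.append_of_mem (hmem i)
    have h := List.nodup_middle.1 hl
    have h1 : ∀ z, l₁.map (Function.update m i z) = l₁.map m := fun z =>
      List.map_congr_left fun k hk => Function.update_of_ne (fun e => by simp_all) _ _
    have h2 : ∀ z, l₂.map (Function.update m i z) = l₂.map m := fun z =>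
      List.map_congr_left fun k hk => Function.update_of_ne (fun e => by simp_all) _ _
    simp [h1, h2, mul_add, add_mul]
  map_update_smul' m i c x := by
    obtain ⟨l₁, l₂, rfl⟩ := List.append_of_mem (hmem i)
    have h := List.nodup_middle.1 hl
    have h1 : ∀ z, l₁.map (Function.update m i z) = l₁.map m := fun z =>
      List.map_congr_left fun k hk => Function.update_of_ne (fun e => by simp_all) _ _
    have h2 : ∀ z, l₂.map (Function.update m i z) = l₂.map m := fun z =>
      List.map_congr_left fun k hk => Function.update_of_ne (fun e => by simp_all) _ _
    simp only [List.map_append, List.map_cons, List.prod_append, List.prod_cons, h1, h2,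
      Function.update_self, smul_mul_assoc, mul_smul_comm]

theorem coeff_list_prod_congr {ι R : Type*} [Ring R] {f g : ι → PowerSeries R} {k : ℕ}
    (h : ∀ i, ∀ m ≤ k, coeff m (f i) = coeff m (g i)) (l : List ι) :
    ∀ m ≤ k, coeff m (l.map f).prod = coeff m (l.map g).prod := by
  induction l with
  | nil => exact fun _ _ => rfl
  | cons i l ih =>
    intro m hm
    rw [List.map_cons, List.map_cons, List.prod_cons, List.prod_cons, coeff_mul, coeff_mul]
    refine sum_congr rfl fun p hp => ?_
    have hp' := mem_antidiagonal.1 hp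
    rw [h i _ (by omega), ih _ (by omega)]

/-- Expansion of a product of generating series of plane partitions. -/
theorem coeff_list_prod_partitions {ι R : Type*} [Fintype ι] [Ring R]
    (A : ι → PlanePartition → R) (l : List ι) (hl : l.Nodup) (hmem : ∀ i, i ∈ l) (k : ℕ) :
    coeff k (l.map fun i => PowerSeries.mk fun m =>
        ∑ π : {π : PlanePartition // π.size = m}, A i π.1).prod =
      ∑ π : {π : ι → PlanePartition // ∑ i, (π i).size = k}, (l.map fun i => A i (π.1 i)).prod := by
  classical
  have := PlanePartition.finite_size_le k
  have := Fintype.ofFinite {π : PlanePartition // π.size ≤ k}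
  -- Up to order `k` each generating series agrees with a finite sum of monomials over partitions of
  -- size at most `k`; the product of these finite sums expands by multilinearity.
  have h1 : ∀ i, ∀ m ≤ k, coeff m (PowerSeries.mk fun m =>
      ∑ π : {π : PlanePartition // π.size = m}, A i π.1) =
      coeff m (∑ π : {π : PlanePartition // π.size ≤ k}, monomial π.1.size (A i π.1)) := by
    intro i m hm
    rw [coeff_mk, map_sum]
    simp only [coeff_monomial]
    rw [← sum_filter]
    refine sum_bij' (fun π _ => ⟨π.1, π.2.trans_le hm⟩) (fun π hπ => ⟨π.1, ?_⟩) ?_ ?_ ?_ ?_ ?_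
    · exact ((mem_filter.1 hπ).2).symm
    · exact fun π _ => mem_filter.2 ⟨mem_univ _, π.2.symm⟩
    · exact fun _ _ => mem_univ _
    · exact fun _ _ => rfl
    · exact fun _ _ => rfl
    · exact fun _ _ => rfl
  rw [coeff_list_prod_congr h1 l k le_rfl]
  have h2 := (listProdMultilinear (PowerSeries R) l hl hmem).map_sum
    (fun i (π : {π : PlanePartition // π.size ≤ k}) => monomial π.1.size (A i π.1))
  change (l.map fun i => _).prod = ∑ r : ι → {π : PlanePartition // π.size ≤ k},
    (l.map fun i => _).prod at h2
  rw [h2, map_sum]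
  have h3 : ∀ s : ι → ℕ, (l.map s).sum = ∑ i, s i := fun s => by
    rw [← List.sum_toFinset _ hl]
    exact sum_congr (eq_univ_of_forall fun i => List.mem_toFinset.2 (hmem i)) fun _ _ => rfl
  simp only [list_prod_map_monomial, coeff_monomial, h3]
  rw [← sum_filter]
  refine sum_bij' (fun φ hφ => ⟨fun i => (φ i).1, ((mem_filter.1 hφ).2).symm⟩)
    (fun π _ i => ⟨π.1 i, ?_⟩) ?_ ?_ ?_ ?_ ?_
  · exact (Finset.single_le_sum (f := fun i => (π.1 i).size)
        (fun _ _ => Nat.zero_le _) (Finset.mem_univ i)).trans π.2.le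
  · exact fun _ _ => mem_univ _
  · exact fun π _ => mem_filter.2 ⟨mem_univ _, π.2.symm⟩
  · exact fun _ _ => rfl
  · exact fun _ _ => rfl
  · exact fun _ _ => rfl

end ListProducts

/-! ### Zero modes, and vacuum expectation values in the full state space -/

section VacuumExpectation

variable (ε : Fin 4 → ℂ)

theorem normalOrderedExp_prod_apply {ι : Type} (E : ι → Exponent) (d : ι → ℤ) (l : List ι)
    (ψ : ZeroModes) (f : Fock) :
    (l.map fun i => normalOrderedExp ε (E i) (d i)).prod (ψ ⊗ₜ[ℂ] f) =
      ((l.map fun i => zeroMode (E i)).prod ψ) ⊗ₜ[ℂ] (oscProd ε E d l f) := by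
  induction l with
  | nil => rfl
  | cons i l ih =>
    rw [List.map_cons, List.prod_cons, Module.End.mul_apply, ih, normalOrderedExp,
      TensorProduct.map_tmul]
    rfl

theorem bra_tmul (ψ : ZeroModes) (f : Fock) : bra (ψ ⊗ₜ[ℂ] f) = ψ (0, 0) * vacuumCoeff f := rfl

/-- The zero mode wave function `e^{u t + w t̃}`. -/
def planeWave (u w : ℂ) : ZeroModes := fun s => Complex.exp (u * s.1 + w * s.2)

theorem zeroMode_planeWave (E : Exponent) (u w : ℂ) :
    zeroMode E (planeWave u w) =
      Complex.exp (u * E .dt) • planeWave (u + E .t) (w + E .tTilde) := by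
  funext s
  change Complex.exp _ * Complex.exp _ = Complex.exp _ * Complex.exp _
  rw [← Complex.exp_add, ← Complex.exp_add]
  congr 1
  ring

variable {ι : Type} [LinearOrder ι]

/-- A factor `e^{E_i t₀}` raises the momentum `u` of the plane wave, and every translation standing
further left picks up the scalar `e^{E_i E_j}` from it; hence `u` and `w` are arbitrary in the
induction. Evaluation at `(0, 0)` removes all dependence on `t̃₀`, and with it the choice of `log
x`. -/
theorem zeroMode_prod_planeWave (E : ι → Exponent) (S : Finset ι) (u w : ℂ) :
    ((S.sort (· ≥ ·)).map fun i => zeroMode (E i)).prod (planeWave u w) (0, 0) =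
      Complex.exp (u * ∑ j ∈ S, E j .dt) *
        ∏ ij ∈ S ×ˢ S with ij.1 < ij.2, Complex.exp (E ij.1 .t * E ij.2 .dt) := by
  induction S using Finset.induction_on_min generalizing u w with
  | empty => simp [planeWave]
  | insert a S ha ih =>
    have haS : a ∉ S := fun h => lt_irrefl _ (ha a h)
    rw [sort_insert_min ha, List.map_append, List.prod_append, List.map_singleton,
      List.prod_singleton, Module.End.mul_apply, zeroMode_planeWave, map_smul, Pi.smul_apply, ih,
      prod_pairs_insert_min (fun i j => Complex.exp (E i .t * E j .dt)) ha, sum_insert haS,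
      ← Complex.exp_sum S, ← mul_sum, smul_eq_mul, ← mul_assoc, ← mul_assoc, ← Complex.exp_add,
      ← Complex.exp_add]
    congr 2
    ring

variable [Fintype ι]

/-- The vacuum expectation value of a product of vertex operators. -/
theorem vev_normalOrderedExp_prod (E : ι → Exponent) (d : ι → ℤ) :
    vev ((univ.sort (· ≥ ·)).map fun i => normalOrderedExp ε (E i) (d i)).prod =
      (∏ ij : ι × ι with ij.1 < ij.2, Complex.exp (E ij.1 .t * E ij.2 .dt)) *
        (∏ ij : ι × ι with ij.1 < ij.2,
          heval (specVar ij.1 / specVar ij.2 : SpectralField ι)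
            (contraction ε (E ij.1) (E ij.2))).coeff (toLex d) := by
  have h := coeff_pairProduct ε E univ d
  rw [if_pos fun i hi => absurd (mem_univ i) hi] at h
  have h1 : (fun _ => 1 : ZeroModes) = planeWave 0 0 := by
    funext s
    simp [planeWave]
  rw [vev, ket, normalOrderedExp_prod_apply, bra_tmul, h1, zeroMode_prod_planeWave, ← h, zero_mul,
    Complex.exp_zero, one_mul]
  rfl

theorem coeff_correlator (face : ι → Fin 4) (L : ι → ℂ) (d : ι → ℤ) (k : ℕ) :
    coeff k (correlator ε face L d) =
      ∑ π : {π : ι → PlanePartition // ∑ i, (π i).size = k},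
        (∏ i, Z7 ε (face i) (π.1 i)) * vev ((univ.sort (· ≥ ·)).map fun i =>
          normalOrderedExp ε (exponentΛ ε (face i) (L i) (π.1 i)) (d i)).prod := by
  rw [correlator, coeff_mk]
  have h := coeff_list_prod_partitions
    (fun i π => Z7 ε (face i) π • normalOrderedExp ε (exponentΛ ε (face i) (L i) π) (d i))
    ((univ : Finset ι).sort (· ≥ ·)) (Finset.sort_nodup _ _)
    (fun i => (Finset.mem_sort _).2 (mem_univ i)) k
  rw [show (fun i => qqChar ε (face i) (L i) (d i)) = fun i => PowerSeries.mk fun m =>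
        ∑ π : {π : PlanePartition // π.size = m},
        Z7 ε (face i) π.1 • normalOrderedExp ε (exponentΛ ε (face i) (L i) π.1) (d i) from rfl, h,
    vev, LinearMap.sum_apply, map_sum]
  refine sum_congr rfl fun π _ => ?_
  rw [list_prod_map_smul (fun i => Z7 ε (face i) (π.1 i)) (fun i =>
    normalOrderedExp ε (exponentΛ ε (face i) (L i) (π.1 i)) (d i)), LinearMap.smul_apply, map_smul, smul_eq_mul, vev]
  congr 1
  rw [← List.prod_toFinset _ (Finset.sort_nodup _ _), Finset.sort_toFinset]

end VacuumExpectation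

/-! ### Contractions of the D6 vertex operators and of the root currents -/

section Contractions

variable (ε : Fin 4 → ℂ)

theorem contractionLog_add_left (E₁ E₂ E' : Exponent) :
    contractionLog ε (E₁ + E₂) E' = contractionLog ε E₁ E' + contractionLog ε E₂ E' := by
  ext n
  simp only [contractionLog, coeff_mk, map_add, Pi.add_apply]
  ring

theorem contractionLog_add_right (E E₁ E₂ : Exponent) :
    contractionLog ε E (E₁ + E₂) = contractionLog ε E E₁ + contractionLog ε E E₂ := by
  ext n
  simp only [contractionLog, coeff_mk, map_add, Pi.add_apply]
  ring

theorem contractionLog_zero_left (E : Exponent) : contractionLog ε 0 E = 0 := by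
  ext n
  simp [contractionLog]

theorem contractionLog_zero_right (E : Exponent) : contractionLog ε E 0 = 0 := by
  ext n
  simp [contractionLog]

theorem contraction_add_left (E₁ E₂ E' : Exponent) :
    contraction ε (E₁ + E₂) E' = contraction ε E₁ E' * contraction ε E₂ E' := by
  rw [contraction, contractionLog_add_left, formalExp_add (coeff_zero_contractionLog _ _ _)
    (coeff_zero_contractionLog _ _ _)]
  rfl

theorem contraction_add_right (E E₁ E₂ : Exponent) :
    contraction ε E (E₁ + E₂) = contraction ε E E₁ * contraction ε E E₂ := by
  rw [contraction, contractionLog_add_right, formalExp_add (coeff_zero_contractionLog _ _ _)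
    (coeff_zero_contractionLog _ _ _)]
  rfl

theorem contraction_sum_left {α : Type*} (s : Finset α) (E : α → Exponent) (E' : Exponent) :
    contraction ε (∑ c ∈ s, E c) E' = ∏ c ∈ s, contraction ε (E c) E' := by
  classical
  induction s using Finset.induction_on with
  | empty => simp [contraction, contractionLog_zero_left, formalExp_zero]
  | insert c s hc ih => rw [sum_insert hc, prod_insert hc, contraction_add_left, ih]

theorem contraction_sum_right {α : Type*} (s : Finset α) (E : Exponent) (E' : α → Exponent) :
    contraction ε E (∑ c ∈ s, E' c) = ∏ c ∈ s, contraction ε E (E' c) := by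
  classical
  induction s using Finset.induction_on with
  | empty => simp [contraction, contractionLog_zero_right, formalExp_zero]
  | insert c s hc ih => rw [sum_insert hc, prod_insert hc, contraction_add_right, ih]

/-- `log (1 - w x)`. -/
def logOneSub (w : ℂ) : PowerSeries ℂ := PowerSeries.mk fun n : ℕ => -(1 / (n : ℂ)) * w ^ n

theorem coeff_zero_logOneSub (w : ℂ) : coeff 0 (logOneSub w) = 0 := by
  rw [logOneSub, coeff_mk]
  simp

theorem formalExp_logOneSub (w : ℂ) : formalExp (logOneSub w) = 1 - C w * X := formalExp_log w

/-- Being a unit passes to images under ring homomorphisms, so the denominators of the rational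
factors stay nonzero after evaluation. -/
theorem isUnit_one_sub (w : ℂ) : IsUnit (1 - C w * X : PowerSeries ℂ) := by
  rw [← formalExp_logOneSub]
  exact IsUnit.of_mul_eq_one_right _ (formalExp_neg_mul (coeff_zero_logOneSub w))

variable {ε}

/-! ### Identities for `P` and the four elementary contractions -/

section Parameters

variable (hCY : ∑ a, ε a = 0)
  (hgen : ∀ m : Fin 4 → ℤ, ∏ a, q ε a ^ m a = 1 → ∀ a b, m a = m b)

include hCY in
theorem prod_q : ∏ a, q ε a = 1 := by
  ext
  rw [Units.coe_prod]
  simp only [q, Units.val_mk0, Units.val_one]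
  rw [← Complex.exp_sum, hCY, Complex.exp_zero]

include hgen in
theorem q_zpow_ne_one (a : Fin 4) {n : ℤ} (hn : n ≠ 0) : q ε a ^ n ≠ 1 := by
  intro h
  obtain ⟨b, hb⟩ := exists_ne a
  have h1 := hgen (Pi.single a n) (by
    rw [Finset.prod_eq_single a, Pi.single_eq_same, h]
    · intro c _ hc
      rw [Pi.single_eq_of_ne hc, zpow_zero]
    · exact fun h => absurd (mem_univ a) h) a b
  rw [Pi.single_eq_same, Pi.single_eq_of_ne hb] at h1
  exact hn h1

include hgen in
theorem P_ne_zero (S : Finset (Fin 4)) {n : ℤ} (hn : n ≠ 0) : P ε S n ≠ 0 :=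
  prod_ne_zero_iff.2 fun a _ h => q_zpow_ne_one hgen a hn (Units.ext (sub_eq_zero.1 h).symm)

theorem P_singleton_mul_compl (a : Fin 4) (n : ℤ) : P ε {a} n * P ε {a}ᶜ n = P ε univ n :=
  prod_mul_prod_compl _ _

theorem P_singleton (a : Fin 4) (n : ℤ) : P ε {a} n = 1 - (q ε a : ℂ) ^ n := by
  rw [P, prod_singleton, Units.val_zpow_eq_zpow_val]

include hCY in
-- Extracting `-q_a^{-n}` from each of the four factors gives sign `+1` and the product of all
-- `q_a^{-n}`, which is `1`.
theorem P_univ_neg (n : ℤ) : P ε univ (-n) = P ε univ n := by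
  have h := prod_q hCY
  have h1 : ∀ a : Fin 4, (1 - ((q ε a ^ (-n) : ℂˣ) : ℂ)) =
      -((q ε a ^ (-n) : ℂˣ) : ℂ) * (1 - ((q ε a ^ n : ℂˣ) : ℂ)) := by
    intro a
    have : ((q ε a ^ (-n) : ℂˣ) : ℂ) * ((q ε a ^ n : ℂˣ) : ℂ) = 1 := by
      rw [← Units.val_mul, zpow_neg, inv_mul_cancel, Units.val_one]
    linear_combination -this
  rw [P, P, prod_congr rfl fun a _ => h1 a, prod_mul_distrib, prod_neg, ← Units.coe_prod,
    prod_zpow, h]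
  simp [show (-1 : ℂ) ^ 4 = 1 by norm_num]

include hCY in
-- Because the `q_a` multiply to `1`, the cubic terms of the expanded product are inverses of single
-- parameters and the quartic term is a second `1`.
theorem P_univ_eq (n : ℤ) : P ε univ n = 2 - ∑ a, (q ε a : ℂ) ^ n - ∑ a, ((q ε a : ℂ)⁻¹) ^ n +
    ∑ ij : Fin 4 × Fin 4 with ij.1 < ij.2, ((q ε ij.1 : ℂ) * q ε ij.2) ^ n := by
  have h : (q ε 0 : ℂ) * q ε 1 * q ε 2 * q ε 3 = 1 := by
    have := congrArg (fun u : ℂˣ => (u : ℂ)) (prod_q hCY)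
    simpa [Fin.prod_univ_four] using this
  have h' : (q ε 0 : ℂ) ^ n * (q ε 1 : ℂ) ^ n * (q ε 2 : ℂ) ^ n * (q ε 3 : ℂ) ^ n = 1 := by
    rw [← mul_zpow, ← mul_zpow, ← mul_zpow, h, one_zpow]
  have hpairs : (univ : Finset (Fin 4 × Fin 4)).filter (fun ij => ij.1 < ij.2) =
      {(0, 1), (0, 2), (0, 3), (1, 2), (1, 3), (2, 3)} := by decide
  rw [P, hpairs]
  repeat rw [sum_insert (by decide)]
  rw [sum_singleton]
  simp only [Fin.prod_univ_four, Fin.sum_univ_four, Units.val_zpow_eq_zpow_val, inv_zpow, mul_zpow]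
  have h0 : (q ε 0 : ℂ) ^ n ≠ 0 := zpow_ne_zero _ (Units.ne_zero _)
  have h1 : (q ε 1 : ℂ) ^ n ≠ 0 := zpow_ne_zero _ (Units.ne_zero _)
  have h2 : (q ε 2 : ℂ) ^ n ≠ 0 := zpow_ne_zero _ (Units.ne_zero _)
  have h3 : (q ε 3 : ℂ) ^ n ≠ 0 := zpow_ne_zero _ (Units.ne_zero _)
  generalize (q ε 0 : ℂ) ^ n = x0 at *
  generalize (q ε 1 : ℂ) ^ n = x1 at *
  generalize (q ε 2 : ℂ) ^ n = x2 at *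
  generalize (q ε 3 : ℂ) ^ n = x3 at *
  have e0 : x0⁻¹ = x1 * x2 * x3 :=
    inv_eq_of_mul_eq_one_right (by linear_combination h')
  have e1 : x1⁻¹ = x0 * x2 * x3 :=
    inv_eq_of_mul_eq_one_right (by linear_combination h')
  have e2 : x2⁻¹ = x0 * x1 * x3 :=
    inv_eq_of_mul_eq_one_right (by linear_combination h')
  have e3 : x3⁻¹ = x0 * x1 * x2 :=
    inv_eq_of_mul_eq_one_right (by linear_combination h')
  rw [e0, e1, e2, e3]
  linear_combination h'

include hCY hgen in
theorem contraction_W_W (a b : Fin 4) (L L' : ℂ) :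
    contraction ε (exponentW ε a L) (exponentW ε b L') = oneLoopSeries ε a b := by
  rw [contraction, oneLoopSeries]
  congr 1
  ext n
  rw [contractionLog, coeff_mk, coeff_mk]
  rcases Nat.eq_zero_or_pos n with rfl | hn
  · simp
  have hn' : (n : ℤ) ≠ 0 := by omega
  have hn'' : -(n : ℤ) ≠ 0 := by omega
  change _ * (1 / P ε {a}ᶜ (- -(n : ℤ)) * (1 / P ε {b}ᶜ (-(n : ℤ)))) = _
  rw [neg_neg]
  have h1 := P_ne_zero hgen {a}ᶜ hn'
  have h2 := P_ne_zero hgen {b}ᶜ hn''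
  have h3 := P_ne_zero hgen univ hn'
  have h4 := P_singleton_mul_compl (ε := ε) a n
  have h5 := P_singleton_mul_compl (ε := ε) b (-n)
  rw [P_univ_neg hCY] at h5
  rw [mul_assoc]
  congr 1
  rw [div_mul_div_comm, mul_div_assoc', div_eq_div_iff (mul_ne_zero h1 h2) h3]
  linear_combination (-(P ε univ n)) * h4 - P ε {a} n * P ε {a}ᶜ n * h5

include hCY hgen in
-- The denominator of `W` cancels three factors of `P_{1234}` and leaves `P_b^{[-n]} = 1 -
-- q_b^{-n}`, the difference of two logarithms. Clearing denominators keeps the identity inside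
-- power series.
theorem contraction_A_W (b : Fin 4) (r : ℂˣ) (L : ℂ) :
    contraction ε (-exponentA r) (exponentW ε b L) * (1 - C (r : ℂ) * X) =
      1 - C ((q ε b : ℂ)⁻¹ * r) * X := by
  rw [← formalExp_logOneSub, ← formalExp_logOneSub, contraction,
    ← formalExp_add (coeff_zero_contractionLog _ _ _) (coeff_zero_logOneSub _)]
  congr 1
  ext n
  rw [map_add, contractionLog, logOneSub, logOneSub, coeff_mk, coeff_mk, coeff_mk]
  rcases Nat.eq_zero_or_pos n with rfl | hn
  · simp
  have hn'' : -(n : ℤ) ≠ 0 := by omega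
  change _ * (-((r ^ (- -(n : ℤ)) : ℂˣ) : ℂ) * (1 / P ε {b}ᶜ (-(n : ℤ)))) + _ = _
  have h2 := P_ne_zero hgen {b}ᶜ hn''
  have h5 := P_singleton_mul_compl (ε := ε) b (-n)
  rw [P_univ_neg hCY, P_singleton, zpow_neg, zpow_natCast] at h5
  rw [neg_neg, zpow_natCast, Units.val_pow_eq_pow_val, ← h5, mul_pow, inv_pow]
  field_simp
  ring

include hgen in
theorem contraction_W_A (a : Fin 4) (r : ℂˣ) (L : ℂ) :
    contraction ε (exponentW ε a L) (-exponentA r) * (1 - C (r : ℂ)⁻¹ * X) =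
      1 - C ((q ε a : ℂ) * (r : ℂ)⁻¹) * X := by
  rw [← formalExp_logOneSub, ← formalExp_logOneSub, contraction,
    ← formalExp_add (coeff_zero_contractionLog _ _ _) (coeff_zero_logOneSub _)]
  congr 1
  ext n
  rw [map_add, contractionLog, logOneSub, logOneSub, coeff_mk, coeff_mk, coeff_mk]
  rcases Nat.eq_zero_or_pos n with rfl | hn
  · simp
  have hn' : (n : ℤ) ≠ 0 := by omega
  change _ * (1 / P ε {a}ᶜ (- -(n : ℤ)) * -((r ^ (-(n : ℤ)) : ℂˣ) : ℂ)) + _ = _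
  have h2 := P_ne_zero hgen {a}ᶜ hn'
  have h5 := P_singleton_mul_compl (ε := ε) a n
  rw [P_singleton, zpow_natCast] at h5
  rw [neg_neg, zpow_neg, zpow_natCast, Units.val_inv_eq_inv_val, Units.val_pow_eq_pow_val, ← h5,
    mul_pow, inv_pow]
  field_simp
  ring

include hCY in
-- Each monomial of `P_univ_eq` contributes one logarithm: the constant `2` gives the square, and
-- the signs decide on which side a factor appears.
theorem contraction_A_A (r s : ℂˣ) :
    contraction ε (-exponentA r) (-exponentA s) *
        ((∏ a, (1 - C ((q ε a : ℂ) * (r / s)) * X)) *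
          ∏ a, (1 - C ((q ε a : ℂ)⁻¹ * (r / s)) * X)) =
      (1 - C (r / s : ℂ) * X) ^ 2 *
        ∏ ij : Fin 4 × Fin 4 with ij.1 < ij.2,
          (1 - C ((q ε ij.1 : ℂ) * q ε ij.2 * (r / s)) * X) := by
  have hs : ∀ (α : Type) (t : Finset α) (w : α → ℂ),
      coeff 0 (∑ i ∈ t, logOneSub (w i)) = 0 := fun α t w => by
    rw [map_sum]
    exact sum_eq_zero fun i _ => coeff_zero_logOneSub _
  have h2 : ∀ w : ℂ, coeff 0 (logOneSub w + logOneSub w) = 0 := fun w => by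
    rw [map_add, coeff_zero_logOneSub, add_zero]
  simp only [← formalExp_logOneSub]
  rw [pow_two, ← formalExp_add (coeff_zero_logOneSub _) (coeff_zero_logOneSub _),
    ← formalExp_sum _ _ fun _ _ => coeff_zero_logOneSub _,
    ← formalExp_sum _ _ fun _ _ => coeff_zero_logOneSub _,
    ← formalExp_sum _ _ fun _ _ => coeff_zero_logOneSub _, contraction,
    ← formalExp_add (hs _ _ _) (hs _ _ _),
    ← formalExp_add (coeff_zero_contractionLog _ _ _) (by rw [map_add, hs, hs, add_zero]),
    ← formalExp_add (h2 _) (hs _ _ _)]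
  congr 1
  ext n
  simp only [map_add, map_sum, contractionLog, logOneSub, coeff_mk, ← mul_sum, mul_pow, ← sum_mul]
  have h := P_univ_eq hCY n
  simp only [zpow_natCast, mul_pow] at h
  change _ * (-((r ^ (- -(n : ℤ)) : ℂˣ) : ℂ) * -((s ^ (-(n : ℤ)) : ℂˣ) : ℂ)) + _ = _
  have e : -((r ^ (- -(n : ℤ)) : ℂˣ) : ℂ) * -((s ^ (-(n : ℤ)) : ℂˣ) : ℂ) = (r / s : ℂ) ^ n := by
    rw [neg_neg, zpow_neg, zpow_natCast, zpow_natCast, Units.val_inv_eq_inv_val,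
      Units.val_pow_eq_pow_val, Units.val_pow_eq_pow_val, neg_mul_neg, div_pow, div_eq_mul_inv]
  rw [e, h]
  ring

end Parameters

end Contractions

/-! ### The correlators of D6 `qq`-characters -/

section Evaluation

theorem exponentΛ_eq (ε : Fin 4 → ℂ) (a : Fin 4) (L : ℂ) (π : PlanePartition) :
    exponentΛ ε a L π = exponentW ε a L + ∑ c ∈ π.cells, -exponentA (boxWeight ε a c) := by
  rw [exponentΛ, sub_eq_add_neg, sum_neg_distrib]

theorem exponentΛ_t (ε : Fin 4 → ℂ) (a : Fin 4) (L : ℂ) (π : PlanePartition) :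
    exponentΛ ε a L π .t = -(π.size : ℂ) := by
  rw [exponentΛ, Pi.sub_apply, Finset.sum_apply]
  simp [exponentW, exponentA, PlanePartition.size]

theorem exponentΛ_dt (ε : Fin 4 → ℂ) (a : Fin 4) (L : ℂ) (π : PlanePartition) :
    exponentΛ ε a L π .dt = -ε a := by
  rw [exponentΛ, Pi.sub_apply, Finset.sum_apply]
  simp [exponentW, exponentA]

/-- This is the source of the prefactor `q_b` per box of the first partition in `pairZ`. -/
theorem exp_zeroMode_pair (ε : Fin 4 → ℂ) (a b : Fin 4) (L L' : ℂ) (π π' : PlanePartition) :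
    Complex.exp (exponentΛ ε a L π .t * exponentΛ ε b L' π' .dt) = (q ε b : ℂ) ^ π.size := by
  rw [exponentΛ_t, exponentΛ_dt, neg_mul_neg, Complex.exp_nat_mul]
  rfl

variable {K : Type*} [Field K] (φ : PowerSeries ℂ →+* K) (κ : ℂ →+* K)

theorem boxContent_eq (ε : Fin 4 → ℂ) (a : Fin 4) (x : K) (c : Fin 3 → ℕ) :
    boxContent (fun k => κ (q ε k)) a x c = x * κ (boxWeight ε a c) := by
  rw [boxContent, boxWeight, Units.coe_prod, map_prod]
  congr 1
  refine prod_congr rfl fun i _ => ?_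
  rw [Units.val_pow_eq_pow_val, map_pow]

variable {φ κ} {x₁ x₂ : K} (hφ : ∀ w : ℂ, φ (1 - C w * X) = 1 - κ w * (x₁ / x₂))

include hφ in
theorem one_sub_ne_zero (w : ℂ) : 1 - κ w * (x₁ / x₂) ≠ 0 := by
  rw [← hφ]
  exact ((isUnit_one_sub w).map φ).ne_zero

variable {ε : Fin 4 → ℂ} (hCY : ∑ a, ε a = 0)
  (hgen : ∀ m : Fin 4 → ℤ, ∏ a, q ε a ^ m a = 1 → ∀ a b, m a = m b)

include hCY hgen hφ in
theorem eval_contraction_A_W (a b : Fin 4) (c : Fin 3 → ℕ) (L : ℂ) :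
    φ (contraction ε (-exponentA (boxWeight ε a c)) (exponentW ε b L)) =
      (1 - (κ (q ε b))⁻¹ * boxContent (fun k => κ (q ε k)) a x₁ c / x₂) /
        (1 - boxContent (fun k => κ (q ε k)) a x₁ c / x₂) := by
  have h1 := congrArg φ (contraction_A_W hCY hgen b (boxWeight ε a c) L)
  rw [map_mul, hφ, hφ] at h1
  have e : boxContent (fun k => κ (q ε k)) a x₁ c / x₂ = κ (boxWeight ε a c) * (x₁ / x₂) := by
    rw [boxContent_eq]
    ring
  rw [mul_div_assoc, e, eq_div_iff (one_sub_ne_zero hφ _), h1, map_mul, map_inv₀, mul_assoc]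

include hgen hφ in
theorem eval_contraction_W_A (a b : Fin 4) (c : Fin 3 → ℕ) (L : ℂ) :
    φ (contraction ε (exponentW ε a L) (-exponentA (boxWeight ε b c))) =
      structV (fun k => κ (q ε k)) a (x₁ / boxContent (fun k => κ (q ε k)) b x₂ c) := by
  have h1 := congrArg φ (contraction_W_A hgen a (boxWeight ε b c) L)
  rw [map_mul, hφ, hφ] at h1
  have e : x₁ / boxContent (fun k => κ (q ε k)) b x₂ c =
      κ (boxWeight ε b c : ℂ)⁻¹ * (x₁ / x₂) := by
    rw [boxContent_eq, map_inv₀, div_mul_eq_div_div]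
    ring
  rw [structV, e, eq_div_iff (one_sub_ne_zero hφ _), h1, map_mul, mul_assoc]

include hCY hφ in
theorem eval_contraction_A_A (a b : Fin 4) (c c' : Fin 3 → ℕ) :
    φ (contraction ε (-exponentA (boxWeight ε a c)) (-exponentA (boxWeight ε b c'))) =
      (structA (fun k => κ (q ε k)) (boxContent (fun k => κ (q ε k)) a x₁ c /
        boxContent (fun k => κ (q ε k)) b x₂ c'))⁻¹ := by
  have h1 := congrArg φ (contraction_A_A hCY (boxWeight ε a c) (boxWeight ε b c'))
  rw [map_mul, map_mul, map_mul, map_pow, map_prod, map_prod, map_prod] at h1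
  simp only [hφ] at h1
  have e : boxContent (fun k => κ (q ε k)) a x₁ c / boxContent (fun k => κ (q ε k)) b x₂ c' =
      κ (boxWeight ε a c / boxWeight ε b c') * (x₁ / x₂) := by
    rw [boxContent_eq, boxContent_eq, map_div₀]
    ring
  rw [structA, inv_div, e, eq_div_iff]
  · simpa only [map_mul, map_inv₀, mul_assoc] using h1
  · refine mul_ne_zero (prod_ne_zero_iff.2 fun k _ => ?_) (prod_ne_zero_iff.2 fun k _ => ?_)
    · rw [← mul_assoc, ← map_mul]
      exact one_sub_ne_zero hφ _
    · rw [← mul_assoc, ← map_inv₀, ← map_mul]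
      exact one_sub_ne_zero hφ _

include hCY hgen hφ in
/-- The contraction of two D6 vertex operators dressed by plane partitions. -/
theorem eval_contraction_Λ (a b : Fin 4) (L L' : ℂ) (π π' : PlanePartition) :
    κ (Complex.exp (exponentΛ ε a L π .t * exponentΛ ε b L' π' .dt)) *
      φ (contraction ε (exponentΛ ε a L π) (exponentΛ ε b L' π')) =
      φ (oneLoopSeries ε a b) * pairZ (fun k => κ (q ε k)) a b x₁ π x₂ π' := by
  have hq : κ ((q ε b : ℂ) ^ π.size) = ∏ _c ∈ π.cells, κ (q ε b) := by
    rw [prod_const, map_pow]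
    rfl
  rw [exp_zeroMode_pair, hq, exponentΛ_eq, exponentΛ_eq, contraction_add_left,
    contraction_add_right, contraction_add_right, contraction_W_W hCY hgen, contraction_sum_left,
    contraction_sum_right, contraction_sum_left]
  simp only [contraction_sum_right, map_mul, map_prod, eval_contraction_A_W hφ hCY hgen,
    eval_contraction_W_A hφ hgen, eval_contraction_A_A hφ hCY]
  rw [pairZ, prod_mul_distrib]
  ring

include hCY hgen in
/-- `eval_contraction_Λ` for operations that are not bundled. -/
theorem eval_contraction_Λ_of_map (f : PowerSeries ℂ → K) (g : ℂ → K) (m : K → K → K)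
    (p : Fin 4 → K) (r : K)
    (hf₀ : f 0 = 0) (hf₁ : f 1 = 1) (hf_add : ∀ s t, f (s + t) = f s + f t)
    (hf_mul : ∀ s t, f (s * t) = f s * f t) (hg₀ : g 0 = 0) (hg₁ : g 1 = 1)
    (hg_add : ∀ s t, g (s + t) = g s + g t) (hg_mul : ∀ s t, g (s * t) = g s * g t)
    (hX : f X = x₁ / x₂) (hC : ∀ w, f (C w) = g w) (hm : ∀ s t, m s t = s * t)
    (hp : ∀ k, p k = g (q ε k)) (a b : Fin 4) (hr : r = f (oneLoopSeries ε a b))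
    (L L' : ℂ) (π π' : PlanePartition) :
    m (g (Complex.exp (exponentΛ ε a L π .t * exponentΛ ε b L' π' .dt)))
      (f (contraction ε (exponentΛ ε a L π) (exponentΛ ε b L' π'))) =
      m r (pairZ p a b x₁ π x₂ π') := by
  let φ : PowerSeries ℂ →+* K := ⟨⟨⟨f, hf₁⟩, hf_mul⟩, hf₀, hf_add⟩
  let κ : ℂ →+* K := ⟨⟨⟨g, hg₁⟩, hg_mul⟩, hg₀, hg_add⟩
  rw [hm, hm, hr, funext hp]
  refine eval_contraction_Λ (φ := φ) (κ := κ) (fun w => ?_) hCY hgen a b L L' π π'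
  rw [map_sub, map_one, map_mul]
  change 1 - f (C w) * f X = 1 - g w * (x₁ / x₂)
  rw [hX, hC]

end Evaluation

/-! ### Correlators in the Hahn series field -/

section Assembly

variable {ι : Type} [LinearOrder ι] [Fintype ι]

theorem const_mul_eq_smul (z : ℂ) (F : SpectralField ι) : const z * F = z • F :=
  HahnSeries.C_mul_eq_smul

theorem const_prod {α : Type*} (s : Finset α) (f : α → ℂ) :
    (const (∏ i ∈ s, f i) : SpectralField ι) = ∏ i ∈ s, const (f i) :=
  map_prod HahnSeries.C f s

variable {ε : Fin 4 → ℂ} (hCY : ∑ a, ε a = 0)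
  (hgen : ∀ m : Fin 4 → ℤ, ∏ a, q ε a ^ m a = 1 → ∀ a b, m a = m b)

include hCY hgen in
theorem heval_contraction_Λ {i j : ι} (h : i < j) (a b : Fin 4) (L L' : ℂ)
    (π π' : PlanePartition) :
    const (Complex.exp (exponentΛ ε a L π .t * exponentΛ ε b L' π' .dt)) *
      heval (specVar i / specVar j : SpectralField ι)
        (contraction ε (exponentΛ ε a L π) (exponentΛ ε b L' π')) =
      pairOneLoop ε a b (specVar i) (specVar j) *
        pairZ (qConst ε) a b (specVar i) π (specVar j) π' := by
  have h₀ : ∀ f : PowerSeries ℂ →ₐ[ℂ] SpectralField ι, f 0 = 0 := map_zero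
  have h₁ : ∀ f : PowerSeries ℂ →ₐ[ℂ] SpectralField ι, f 1 = 1 := map_one
  have hC : ∀ w, heval (specVar i / specVar j : SpectralField ι) (C w) = const w := fun w => by
    rw [heval_C, ← HahnSeries.C_mul_eq_smul, mul_one]
    rfl
  have h₂ := @eval_contraction_Λ_of_map (SpectralField ι) _ (specVar i) (specVar j) ε hCY hgen
    (fun s => heval (specVar i / specVar j : SpectralField ι) s) const (fun s t => s * t)
    (qConst ε) (pairOneLoop ε a b (specVar i) (specVar j))
    (h₀ _) (h₁ _) (map_add _) (map_mul _) (map_zero HahnSeries.C)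
    (map_one HahnSeries.C) (map_add HahnSeries.C) (map_mul HahnSeries.C)
    (heval_X _ (orderTop_specVar_div_pos h)) hC (fun _ _ => rfl) (fun _ => rfl) a b rfl L L' π π'
  with_reducible exact h₂

include hCY hgen in
/-- The correlator of D6 `qq`-characters on arbitrary faces. -/
theorem isCorrelator_oneLoop_mul (face : ι → Fin 4) (L : ι → ℂ) :
    IsCorrelator ε face L (PowerSeries.C (oneLoop ε face) * PowerSeries.mk fun k =>
      ∑ π : {π : ι → PlanePartition // ∑ i, (π i).size = k},
        (∏ i, const (Z7 ε (face i) (π.1 i))) *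
          ∏ ij : ι × ι with ij.1 < ij.2, pairZ (qConst ε) (face ij.1) (face ij.2)
            (specVar ij.1) (π.1 ij.1) (specVar ij.2) (π.1 ij.2)) := by
  intro k d
  rw [coeff_correlator, coeff_C_mul, coeff_mk, mul_sum, HahnSeries.coeff_sum]
  refine sum_congr rfl fun π _ => ?_
  -- Complex scalars move inside the coefficient, so that each zero mode factor can be paired with
  -- the contraction of the same pair of branes.
  have hc : ∀ (z : ℂ) (F : SpectralField ι), z * F.coeff (toLex d) =
      (const z * F).coeff (toLex d) := fun z F => by
    rw [const_mul_eq_smul, HahnSeries.coeff_smul, smul_eq_mul]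
  rw [vev_normalOrderedExp_prod, hc, hc, const_prod, const_prod, ← prod_mul_distrib]
  congr 1
  rw [mul_left_comm, oneLoop, ← prod_mul_distrib]
  congr 1
  exact prod_congr rfl fun ij hij =>
    (heval_contraction_Λ hCY hgen (mem_filter.1 hij).2 _ _ _ _ _ _).symm

include hCY hgen in
/-- The correlator of two D6 `qq`-characters. -/
theorem isCorrelator_oneLoop_mul_two (face : Fin 2 → Fin 4) {a b : Fin 4} (ha : face 0 = a)
    (hb : face 1 = b) (L : Fin 2 → ℂ) :
    IsCorrelator ε face L (PowerSeries.C (oneLoop ε face) * PowerSeries.mk fun k =>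
      ∑ π : {π : Fin 2 → PlanePartition // ∑ i, (π i).size = k},
        const (Z7 ε a (π.1 0)) * const (Z7 ε b (π.1 1)) *
          pairZ (qConst ε) a b (specVar (0 : Fin 2)) (π.1 0) (specVar 1) (π.1 1)) := by
  subst ha hb
  intro k d
  rw [← isCorrelator_oneLoop_mul hCY hgen face L k d, PowerSeries.coeff_C_mul,
    PowerSeries.coeff_C_mul, PowerSeries.coeff_mk, PowerSeries.coeff_mk]
  have h : (Finset.univ : Finset (Fin 2 × Fin 2)).filter (fun ij => ij.1 < ij.2) = {(0, 1)} := by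
    decide
  refine congrArg (fun s => (oneLoop ε face * s).coeff (toLex d))
    (Finset.sum_congr rfl fun π _ => ?_)
  rw [h, Finset.prod_singleton, Fin.prod_univ_two]

/-- A single normally ordered operator has nothing to contract with: the annihilation part acts
trivially on the vacuum, the creation part on the dual vacuum. -/
theorem vev_normalOrderedExp (E : Exponent) (d : ℤ) :
    vev (normalOrderedExp ε E d) = if d = 0 then 1 else 0 := by
  have h1 : vacuumCoeff (1 : Fock) = 1 := by
    change MvPolynomial.coeff 0 (1 : Fock) = 1
    simp
  rw [vev, ket, normalOrderedExp, TensorProduct.map_tmul, bra_tmul, oscMode_one]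
  have h2 : zeroMode E (fun _ => 1) (0, 0) = 1 := by
    change Complex.exp _ * 1 = 1
    simp
  rw [h2, one_mul]
  by_cases hd : d = 0
  · rw [if_pos hd, if_pos hd.ge, vacuumCoeff_creationCoeff, if_pos (by omega), h1]
  · rw [if_neg hd]
    split_ifs with h
    · rw [vacuumCoeff_creationCoeff, if_neg (by omega)]
    · exact map_zero _

theorem vev_coeff_qqChar (a : Fin 4) (L : ℂ) (k : ℕ) (d : ℤ) :
    vev (PowerSeries.coeff k (qqChar ε a L d)) =
      if d = 0 then ∑ π : {π : PlanePartition // π.size = k}, Z7 ε a π.1 else 0 := by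
  rw [qqChar, coeff_mk, vev, LinearMap.sum_apply, map_sum]
  have h : ∀ π : {π : PlanePartition // π.size = k},
      bra ((Z7 ε a π.1 • normalOrderedExp ε (exponentΛ ε a L π.1) d) ket) =
        if d = 0 then Z7 ε a π.1 else 0 := fun π => by
    have := vev_normalOrderedExp (ε := ε) (exponentΛ ε a L π.1) d
    rw [vev] at this
    rw [LinearMap.smul_apply, map_smul, this, smul_eq_mul, mul_ite, mul_one, mul_zero]
  rw [sum_congr rfl fun π _ => h π]
  split_ifs
  · rfl
  · exact sum_const_zero

end Assembly

/-! ### Products over lexicographically ordered branes -/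

section Branes

variable {n : Fin 4 → ℕ}

theorem prod_branes {M : Type*} [CommMonoid M] (f : Branes n → M) :
    ∏ i, f i = ∏ a, ∏ α, f (brane a α) := by
  rw [← Fintype.prod_equiv toLex (fun x : Σ a, Fin (n a) => f (toLex x)) f fun _ => rfl,
    ← univ_sigma_univ, prod_sigma]
  rfl

theorem brane_lt_brane {a b : Fin 4} {α : Fin (n a)} {β : Fin (n b)} :
    brane a α < brane b β ↔ a < b ∨ ∃ h : a = b, h ▸ α < β :=
  Sigma.lex_iff

/-- A lexicographically increasing pair either lies on one face with increasing second index, or on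
two increasing faces with arbitrary second indices. -/
theorem prod_branes_lt {M : Type*} [CommMonoid M] (g : Branes n → Branes n → M) :
    ∏ ij : Branes n × Branes n with ij.1 < ij.2, g ij.1 ij.2 =
      (∏ a : Fin 4, ∏ αβ : Fin (n a) × Fin (n a) with αβ.1 < αβ.2,
        g (brane a αβ.1) (brane a αβ.2)) *
      ∏ ab : Fin 4 × Fin 4 with ab.1 < ab.2, ∏ α : Fin (n ab.1), ∏ β : Fin (n ab.2),
        g (brane ab.1 α) (brane ab.2 β) := by
  have key : ∀ a b : Fin 4, (∏ α : Fin (n a), ∏ β : Fin (n b),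
      if brane a α < brane b β then g (brane a α) (brane b β) else 1) =
      (if a = b then ∏ α : Fin (n a), ∏ β : Fin (n a),
        if α < β then g (brane a α) (brane a β) else 1 else 1) *
      if a < b then ∏ α : Fin (n a), ∏ β : Fin (n b), g (brane a α) (brane b β) else 1 := by
    intro a b
    rcases lt_trichotomy a b with h | rfl | h
    · simp [brane_lt_brane, h, h.ne]
    · simp [brane_lt_brane]
    · simp [brane_lt_brane, h.not_gt, h.ne']
  simp only [prod_filter, Fintype.prod_prod_type, prod_branes]
  rw [prod_congr rfl fun a _ => prod_comm, prod_congr rfl fun a _ => prod_congr rfl fun b _ =>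
    key a b]
  simp only [prod_mul_distrib, prod_ite_eq, mem_univ, if_true]

end Branes

end GaugeOrigami

end

/-! ### The tetrahedron instanton correlator and its special cases -/

theorem mainTheorem5 (ε : Fin 4 → ℂ) (hCY : ∑ a, ε a = 0)
    (hgen : ∀ m : Fin 4 → ℤ, ∏ a, q ε a ^ m a = 1 → ∀ a b, m a = m b) :
    -- the tetrahedron instanton partition function
    (∀ (n : Fin 4 → ℕ) (L : Branes n → ℂ),
      PowerSeries.C (oneLoop ε Branes.face) * Zinst ε n =
        PowerSeries.mk (fun k =>
          ∑ π : {π : Branes n → PlanePartition // ∑ i, (π i).size = k},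
            oneLoop ε Branes.face * Ztet ε n π.1) ∧
      IsCorrelator ε Branes.face L (PowerSeries.C (oneLoop ε Branes.face) * Zinst ε n)) ∧
    -- the 7d `U(1)` theory on one face
    (∀ (a : Fin 4) (L : ℂ) (k : ℕ) (d : ℤ),
      vev (PowerSeries.coeff k (qqChar ε a L d)) =
        if d = 0 then ∑ π : {π : PlanePartition // π.size = k}, Z7 ε a π.1 else 0) ∧
    -- the 7d `U(N)` theory on one face
    (∀ (a : Fin 4) (N : ℕ) (L : Fin N → ℂ),
      IsCorrelator ε (fun _ => a) L
        (PowerSeries.C (oneLoop ε fun _ => a) * PowerSeries.mk fun k =>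
          ∑ π : {π : Fin N → PlanePartition // ∑ i, (π i).size = k},
            (∏ i, const (Z7 ε a (π.1 i))) *
              ∏ ij : Fin N × Fin N with ij.1 < ij.2,
                pairZ (qConst ε) a a (specVar ij.1) (π.1 ij.1) (specVar ij.2) (π.1 ij.2))) ∧
    -- generalized folded instantons: `⟨0| T_{123}(v) T_{234}(v') |0⟩`
    (∀ L : Fin 2 → ℂ,
      IsCorrelator ε ![0, 3] L
        (PowerSeries.C (oneLoop ε ![0, 3]) * PowerSeries.mk fun k =>
          ∑ π : {π : Fin 2 → PlanePartition // ∑ i, (π i).size = k},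
            const (Z7 ε 0 (π.1 0)) * const (Z7 ε 3 (π.1 1)) *
              pairZ (qConst ε) 0 3 (specVar (0 : Fin 2)) (π.1 0) (specVar 1) (π.1 1))) := by
  refine ⟨fun n L => ⟨?_, ?_⟩, fun a L k d => vev_coeff_qqChar a L k d, fun a N L => ?_, fun L => ?_⟩
  · ext1 k
    rw [PowerSeries.coeff_C_mul, Zinst, PowerSeries.coeff_mk, PowerSeries.coeff_mk, Finset.mul_sum]
  -- Only the grouping differs: `Ztet` separates pairs on one face from pairs on two faces, whereas
  -- the general correlator runs over all ordered pairs of branes.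
  · convert isCorrelator_oneLoop_mul hCY hgen (Branes.face (n := n)) L using 3
    rw [Zinst]
    congr 1
    funext k
    refine Finset.sum_congr rfl fun π _ => ?_
    rw [Ztet, mul_assoc, prod_branes, prod_branes_lt (fun i j => pairZ (qConst ε) i.face j.face
      (specVar i) (π.1 i) (specVar j) (π.1 j))]
    rfl
  · exact isCorrelator_oneLoop_mul hCY hgen (fun _ => a) L
  -- Faces are labelled by the omitted direction counted from `0`: label `0` is `234`, whose
  -- operator stands on the right, and label `3` is `123`.
  · have h := isCorrelator_oneLoop_mul_two hCY hgen ![0, 3] (a := 0) (b := 3) rfl rfl L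
    with_reducible exact h
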